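/- Let $\mathcal C$ be an essentially small triangulated category, let $K(\mathcal C)$ be its Grothendieck group, and let $q:K(\mathcal C)\twoheadrightarrow A$ be a surjective homomorphism onto an abelian group $A$ of finite rank, i.e. a finitely generated abelian group. A stability condition $\sigma=(Z_\sigma,\mathcal P_\sigma)$ on $\mathcal C$ consists of a homomorphism $Z_\sigma:K(\mathcal C)\to\mathbb C$ and full (strict) additive subcategories $\mathcal P_\sigma(\varphi)\subset\mathcal C$, $\varphi\in\mathbb R$, such that: $Z_\sigma(c)\in\mathbb R_{>0}e^{i\pi\varphi}$ for $0\ne c\in\mathcal P_\sigma(\varphi)$; $\mathcal P_\sigma(\varphi+1)=\mathcal P_\sigma(\varphi)[1]$; $\mathrm{Hom}(c,c')=0$ for $c\in\mathcal P_\sigma(\varphi)$, $c'\in\mathcal P_\sigma(\varphi')$, $\varphi>\varphi'$; and every $c\neq0$ has a Harder–Narasimhan filtration with nonzero factors $b_j\in\mathcal P_\sigma(\varphi_j)$, $\varphi_1>\dots>\varphi_n$. Put $\varphi^+_\sigma(c)=\varphi_1$, $\varphi^-_\sigma(c)=\varphi_n$, $m_\sigma(c)=\sum_j|Z_\sigma(b_j)|$,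 and let $$d(\sigma,\tau)=\sup_{0\neq c\in\mathcal C}\max\Big\{|\varphi_\sigma^-(c)-\varphi_\tau^-(c)|,\ |\varphi_\sigma^+(c)-\varphi_\tau^+(c)|,\ \Big|\log\frac{m_\sigma(c)}{m_\tau(c)}\Big|\Big\}\in[0,\infty].$$ Write $\langle S\rangle$ for the ext-closed full subcategory generated by a class $S$ of objects, and for an interval $I$ let $\mathcal P_\sigma(I)=\langle\mathcal P_\sigma(\varphi)\mid\varphi\in I\rangle$, which is quasi-abelian when $I$ has length $<1$. Call $\sigma$ locally-finite if for every $t\in\mathbb R$ there is $\epsilon\in(0,\tfrac12)$ such that $\mathcal P_\sigma(t-\epsilon,t+\epsilon)$ is artinian and noetherian (with respect to strict subobjects), and locally-length if for every $t\in\mathbb R$ there is $\epsilon\in(0,\tfrac12)$ such that $\mathcal P_\sigma(t-\epsilon,t+\epsilon)$ is a quasi-abelian length category, i.e. every object $a\neq0$ has a length $l(a)\in\mathbb N$ such that every filtration of $a$ by strict subobjects (with proper inclusions) has length at most $l(a)$, with equality for some filtration. Give the set of locally-finite stability conditions whose central charge factors through $q$ the topology induced by $d$. Let $\mathrm{Stab}^\circ$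 be a connected component of this space which is full, i.e. such that the projection $\mathrm{Stab}^\circ\to\mathrm{Hom}(A,\mathbb C)$, taking $\sigma$ to the homomorphism induced by $Z_\sigma$, is a local homeomorphism. Then $\mathrm{Stab}^\circ$ is complete for $d$. Moreover every Cauchy sequence $\sigma_n=(Z_n,\mathcal P_n)$ in $\mathrm{Stab}^\circ$ has a unique limit in $\mathrm{Stab}^\circ$; it is $\sigma=(Z,\mathcal P)$ with $Z=\lim_n Z_n$ (pointwise on $K(\mathcal C)$) and $$\mathcal P(\theta)=\big\langle\, 0\neq c\in\mathcal C\ \big|\ \varphi_{\sigma_n}^+(c)\to\theta\ \text{and}\ \varphi_{\sigma_n}^-(c)\to\theta\,\big\rangle\qquad(\theta\in\mathbb R),$$ and $\sigma$ is locally-length. -/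

import Mathlib

open CategoryTheory CategoryTheory.Limits CategoryTheory.Pretriangulated Filter Topology
open scoped ENNReal

universe v u w

noncomputable section

namespace Stability

/-! ### Quasi-abelian categories, strict subobjects, lengths -/

section QuasiAbelian

/-- A quasi-abelian category: an additive category with kernels and cokernels in which strict
epimorphisms are stable under pullback and strict monomorphisms are stable under pushout.
In a category with kernels and cokernels the strict monomorphisms are exactly the morphisms that
are a kernel of some morphism (`NormalMono`), and dually for strict epimorphisms. -/
structure IsQuasiAbelian (D : Type u) [Category.{v} D] [Preadditive D] : Prop where
  hasFiniteBiproducts : HasFiniteBiproducts D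
  hasKernels : HasKernels D
  hasCokernels : HasCokernels D
  strictEpi_pullback : ∀ {W X Y Z : D} (fst : W ⟶ X) (snd : W ⟶ Y) (f : X ⟶ Z) (g : Y ⟶ Z),
    IsPullback fst snd f g → Nonempty (NormalEpi g) → Nonempty (NormalEpi fst)
  strictMono_pushout : ∀ {Z X Y W : D} (f : Z ⟶ X) (g : Z ⟶ Y) (inl : X ⟶ W) (inr : Y ⟶ W),
    IsPushout f g inl inr → Nonempty (NormalMono g) → Nonempty (NormalMono inl)

/-- The partially ordered set of strict subobjects of `X`. In a quasi-abelian category the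
inclusion of one strict subobject of `X` into a larger one is again a strict monomorphism, so
chains in this set are the same as filtrations of `X` by strict subobjects. -/
def StrictSubobject {D : Type u} [Category.{v} D] [HasZeroMorphisms D] (X : D) :
    Type (max u v) :=
  {S : Subobject X // Nonempty (NormalMono S.arrow)}

instance {D : Type u} [Category.{v} D] [HasZeroMorphisms D] (X : D) :
    PartialOrder (StrictSubobject X) :=
  inferInstanceAs (PartialOrder {S : Subobject X // Nonempty (NormalMono S.arrow)})

/-- A quasi-abelian category which is artinian and noetherian: there are no infinite strictly
descending, and no infinite strictly ascending, chains of strict subobjects of an object. -/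
structure IsArtinianNoetherian (D : Type u) [Category.{v} D] [Preadditive D] : Prop where
  isQuasiAbelian : IsQuasiAbelian D
  artinian : ∀ X : D, WellFoundedLT (StrictSubobject X)
  noetherian : ∀ X : D, WellFoundedGT (StrictSubobject X)

/-- A quasi-abelian length category: every nonzero object `X` has a length `l`, which bounds the
length of every chain `S₀ < S₁ < ⋯ < Sₖ` of strict subobjects of `X` and is attained by one. -/
structure IsLengthCategory (D : Type u) [Category.{v} D] [Preadditive D] : Prop where
  isQuasiAbelian : IsQuasiAbelian D
  exists_length : ∀ X : D, ¬ IsZero X → ∃ l : ℕ,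
    (∀ p : LTSeries (StrictSubobject X), p.length ≤ l) ∧
      ∃ p : LTSeries (StrictSubobject X), p.length = l

end QuasiAbelian

/-! ### Triangulated categories -/

section Triangulated

variable (C : Type u) [Category.{v} C] [Preadditive C] [HasZeroObject C] [HasShift C ℤ]
  [∀ n : ℤ, (shiftFunctor C n).Additive] [Pretriangulated C]

/-- The relations `[b] = [a] + [c]`, one for each exact triangle `a ⟶ b ⟶ c ⟶ a⟦1⟧`. -/
def K0Relations : AddSubgroup (FreeAbelianGroup C) :=
  AddSubgroup.closure {x | ∃ T ∈ distTriang C,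
    x = FreeAbelianGroup.of T.obj₂ - FreeAbelianGroup.of T.obj₁ - FreeAbelianGroup.of T.obj₃}

/-- The Grothendieck group of a triangulated category. -/
abbrev K0 : Type u := FreeAbelianGroup C ⧸ K0Relations C

variable {C}

/-- The class of an object in the Grothendieck group. -/
def K0.mk (X : C) : K0 C := QuotientAddGroup.mk (FreeAbelianGroup.of X)

/-- The ext-closed (strict, full) subcategory `⟨S⟩` generated by a class `S` of objects. -/
inductive ExtClosure (S : ObjectProperty C) : ObjectProperty C
  | zero (X : C) : IsZero X → ExtClosure S X
  | of (X : C) : S X → ExtClosure S X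
  | iso (X Y : C) : (X ≅ Y) → ExtClosure S X → ExtClosure S Y
  | ext (T : Triangle C) : T ∈ distTriang C →
      ExtClosure S T.obj₁ → ExtClosure S T.obj₃ → ExtClosure S T.obj₂

/-- A Harder--Narasimhan filtration of `X` with respect to the subcategories `P φ`, with
`n + 1` nonzero factors: exact triangles
`obj i ⟶ obj (i + 1) ⟶ factor i ⟶ (obj i)⟦1⟧` for `i = 0, …, n`, where `obj 0 = 0`,
`obj (n + 1) ≅ X`, and `factor i` lies in `P (phase i)` with strictly decreasing phases. -/
structure HNFiltration (P : ℝ → ObjectProperty C) (X : C) where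
  n : ℕ
  obj : Fin (n + 2) → C
  factor : Fin (n + 1) → C
  phase : Fin (n + 1) → ℝ
  ι : ∀ i : Fin (n + 1), obj i.castSucc ⟶ obj i.succ
  π : ∀ i : Fin (n + 1), obj i.succ ⟶ factor i
  δ : ∀ i : Fin (n + 1), factor i ⟶ (obj i.castSucc)⟦(1 : ℤ)⟧
  triangle_mem : ∀ i : Fin (n + 1), Triangle.mk (ι i) (π i) (δ i) ∈ distTriang C
  isZero_obj_zero : IsZero (obj 0)
  topIso : obj (Fin.last (n + 1)) ≅ X
  phase_strictAnti : StrictAnti phase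
  factor_mem : ∀ i, P (phase i) (factor i)
  factor_not_isZero : ∀ i, ¬ IsZero (factor i)

variable (C) in
/-- A stability condition `(Z, P)`. -/
structure StabilityCondition where
  /-- the central charge -/
  Z : K0 C →+ ℂ
  /-- `P φ` is the full subcategory of semistable objects of phase `φ` (and zero objects) -/
  P : ℝ → ObjectProperty C
  P_iso : ∀ (φ : ℝ) {X Y : C}, (X ≅ Y) → P φ X → P φ Y
  P_zero : ∀ (φ : ℝ) (X : C), IsZero X → P φ X
  P_biprod : ∀ (φ : ℝ) (X Y : C), P φ X → P φ Y → P φ (X ⊞ Y)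
  charge : ∀ (φ : ℝ) (X : C), P φ X → ¬ IsZero X →
    ∃ m : ℝ, 0 < m ∧ Z (K0.mk X) = m * Complex.exp (Complex.I * Real.pi * φ)
  P_shift : ∀ (φ : ℝ) (X : C), P (φ + 1) X ↔ ∃ Y : C, P φ Y ∧ Nonempty (X ≅ Y⟦(1 : ℤ)⟧)
  hom_eq_zero : ∀ (φ φ' : ℝ) (X Y : C), φ' < φ → P φ X → P φ' Y → ∀ f : X ⟶ Y, f = 0
  exists_hn : ∀ X : C, ¬ IsZero X → Nonempty (HNFiltration P X)

namespace StabilityCondition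

variable (σ τ : StabilityCondition C)

/-- A Harder--Narasimhan filtration of a nonzero object (it is unique up to isomorphism). -/
def hn (X : C) (hX : ¬ IsZero X) : HNFiltration σ.P X := (σ.exists_hn X hX).some

open scoped Classical in
/-- The maximal phase `φ⁺(X)` of a nonzero object: the phase of the first factor. -/
def phiPlus (X : C) : ℝ :=
  if hX : IsZero X then 0 else (σ.hn X hX).phase 0

open scoped Classical in
/-- The minimal phase `φ⁻(X)` of a nonzero object: the phase of the last factor. -/
def phiMinus (X : C) : ℝ :=
  if hX : IsZero X then 0 else (σ.hn X hX).phase (Fin.last _)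

open scoped Classical in
/-- The mass of a nonzero object: the sum of the `|Z(b)|` over its semistable factors `b`. -/
def mass (X : C) : ℝ :=
  if hX : IsZero X then 0 else ∑ i, ‖σ.Z (K0.mk ((σ.hn X hX).factor i))‖

/-- The subcategory `P(I)` generated by the semistable objects with phases in `I`. -/
def phaseInterval (I : Set ℝ) : ObjectProperty C :=
  ExtClosure (fun X => ∃ φ ∈ I, σ.P φ X)

/-- Local finiteness: each `t` has a neighbourhood `(t - ε, t + ε)` of length `< 1` for which
`P(t - ε, t + ε)` is an artinian and noetherian quasi-abelian category. -/
def IsLocallyFinite : Prop :=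
  ∀ t : ℝ, ∃ ε : ℝ, 0 < ε ∧ ε < 1 / 2 ∧
    IsArtinianNoetherian (σ.phaseInterval (Set.Ioo (t - ε) (t + ε))).FullSubcategory

/-- Locally-length: each `t` has a neighbourhood `(t - ε, t + ε)` of length `< 1` for which
`P(t - ε, t + ε)` is a quasi-abelian length category. -/
def IsLocallyLength : Prop :=
  ∀ t : ℝ, ∃ ε : ℝ, 0 < ε ∧ ε < 1 / 2 ∧
    IsLengthCategory (σ.phaseInterval (Set.Ioo (t - ε) (t + ε))).FullSubcategory

lemma mass_pos (X : C) (hX : ¬ IsZero X) : 0 < σ.mass X := by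
  rw [mass, dif_neg hX]
  refine Finset.sum_pos (fun i _ => ?_) ⟨0, Finset.mem_univ _⟩
  obtain ⟨m, hm, h⟩ := σ.charge _ _ ((σ.hn X hX).factor_mem i) ((σ.hn X hX).factor_not_isZero i)
  rw [h, norm_pos_iff]
  exact mul_ne_zero (by exact_mod_cast hm.ne') (Complex.exp_ne_zero _)

/-- The quantity whose supremum over the nonzero objects `X` is the distance. -/
def distAt (X : C) : ℝ :=
  max (max |σ.phiMinus X - τ.phiMinus X| |σ.phiPlus X - τ.phiPlus X|)
    |Real.log (σ.mass X / τ.mass X)|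

/-- Bridgeland's generalised metric, with values in `[0, ∞]`. -/
def dist : ℝ≥0∞ := ⨆ (X : C) (_ : ¬ IsZero X), ENNReal.ofReal (distAt σ τ X)

lemma distAt_self (X : C) (hX : ¬ IsZero X) : distAt σ σ X = 0 := by
  simp [distAt, div_self (σ.mass_pos X hX).ne']

lemma distAt_comm (X : C) : distAt σ τ X = distAt τ σ X := by
  rw [distAt, distAt, abs_sub_comm (σ.phiMinus X), abs_sub_comm (σ.phiPlus X),
    ← abs_neg (Real.log (σ.mass X / τ.mass X)), ← Real.log_inv, inv_div]

lemma distAt_triangle (ρ : StabilityCondition C) (X : C) (hX : ¬ IsZero X) :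
    distAt σ ρ X ≤ distAt σ τ X + distAt τ ρ X := by
  have h1 := (σ.mass_pos X hX).ne'
  have h2 := (τ.mass_pos X hX).ne'
  have h3 := (ρ.mass_pos X hX).ne'
  simp only [distAt, Real.log_div h1 h2, Real.log_div h2 h3, Real.log_div h1 h3]
  refine max_le (max_le ?_ ?_) ?_
  · exact (abs_sub_le _ (τ.phiMinus X) _).trans
      (add_le_add ((le_max_left _ _).trans (le_max_left _ _))
        ((le_max_left _ _).trans (le_max_left _ _)))
  · exact (abs_sub_le _ (τ.phiPlus X) _).trans
      (add_le_add ((le_max_right _ _).trans (le_max_left _ _))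
        ((le_max_right _ _).trans (le_max_left _ _)))
  · exact (abs_sub_le _ (Real.log (τ.mass X)) _).trans
      (add_le_add (le_max_right _ _) (le_max_right _ _))

/-- The generalised metric makes the set of stability conditions a uniform and a topological
space. -/
instance : PseudoEMetricSpace (StabilityCondition C) where
  edist := dist
  edist_self σ := by
    simp only [dist, ENNReal.iSup_eq_zero]
    intro X hX
    rw [distAt_self σ X hX, ENNReal.ofReal_zero]
  edist_comm σ τ := by
    simp only [dist]
    exact iSup_congr fun X => by rw [distAt_comm]
  edist_triangle σ τ ρ := by
    refine iSup₂_le fun X hX => ?_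
    refine (ENNReal.ofReal_le_ofReal (distAt_triangle σ τ ρ X hX)).trans ?_
    refine ENNReal.ofReal_add_le.trans (add_le_add ?_ ?_)
    · exact le_iSup₂ (f := fun (X : C) (_ : ¬ IsZero X) => ENNReal.ofReal (distAt σ τ X)) X hX
    · exact le_iSup₂ (f := fun (X : C) (_ : ¬ IsZero X) => ENNReal.ofReal (distAt τ ρ X)) X hX

end StabilityCondition

/-- The topology of pointwise convergence on `Hom(A, ℂ)`. For `A` finitely generated this is the
usual topology of a finite-dimensional complex vector space. -/
instance homTopology (A : Type w) [AddCommGroup A] : TopologicalSpace (A →+ ℂ) :=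
  TopologicalSpace.induced (fun f : A →+ ℂ => (f : A → ℂ)) inferInstance

/-- The space of locally-finite stability conditions whose central charge factors through
`q : K0 C →+ A`. (For surjective `q` the factorisation is unique.) -/
structure StabThrough {A : Type w} [AddCommGroup A] (q : K0 C →+ A) where
  toStabilityCondition : StabilityCondition C
  isLocallyFinite : toStabilityCondition.IsLocallyFinite
  /-- the induced homomorphism `A → ℂ` -/
  charge : A →+ ℂ
  charge_comp : charge.comp q = toStabilityCondition.Z

/-- The generalised metric restricted to the subspace. -/
instance {A : Type w} [AddCommGroup A] (q : K0 C →+ A) : PseudoEMetricSpace (StabThrough q) :=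
  PseudoEMetricSpace.induced StabThrough.toStabilityCondition inferInstance

/-- A set of stability conditions is full if the projection to `Hom(A, ℂ)` is a local
homeomorphism on it. -/
def IsFull {A : Type w} [AddCommGroup A] {q : K0 C →+ A} (S : Set (StabThrough q)) : Prop :=
  IsLocalHomeomorph (fun σ : S => (σ : StabThrough q).charge)

/-- The limiting semistable objects of phase `θ` of a sequence of stability conditions: the
ext-closed subcategory generated by the nonzero objects whose phases `φₙ⁺`, `φₙ⁻` both tend
to `θ`. -/
def limitingSemistable (σ : ℕ → StabilityCondition C) (θ : ℝ) : ObjectProperty C :=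
  ExtClosure (fun X => ¬ IsZero X ∧
    Tendsto (fun n => (σ n).phiPlus X) atTop (𝓝 θ) ∧
    Tendsto (fun n => (σ n).phiMinus X) atTop (𝓝 θ))

end Triangulated

end Stability

end

/-! The engine is a lower bound on masses. On a full component the charge of `σ` can be moved a
small distance `t` along each of finitely many integral coordinates of `A` while staying within
distance 1 of `σ`. The class of a nonzero semistable `E` has a nonzero coordinate, otherwise it
would be torsion and have charge 0; so moving along that coordinate changes the charge of `E` by at
least `t`. Both charges are bounded by masses of `E`, which differ at most by a factor `e`; hence
`|Z(E)|` is bounded below (`IsFull.exists_charge_bound`). Along a Cauchy sequence the bound can be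
taken uniform, because the logarithms of masses are uniformly Cauchy.

Given a uniform bound `δ`, the phases and masses of each object converge, and the point is to build
Harder–Narasimhan filtrations with limiting semistable factors. If the extreme limiting phases of
`X` differ, the mass bounds the number of factors of `X` for `σₙ`, so some gap between consecutive
phases is large compared with the remaining variation of the sequence. Cutting `X` at that gap gives
two pieces whose phases stay separated for all later indices (`exists_separation`). Masses add over
the cut and each piece has mass at least `δ`, so the process stops (`exists_isHN_of_mass_le`). On
limiting semistable objects the charge is asymptotically mass times `exp (iπθ)`, so charges converge
there, and by additivity on the whole Grothendieck group (`exists_limit`). Convergence in the metric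
follows by letting one index of the Cauchy estimate tend to infinity.

The limit inherits the bound `δ`. For objects with phases near `t`, the real part of the charge
rotated by `exp (-iπt)` is additive and at least `δ / 2`, which bounds the length of chains of
strict subobjects. With the quasi-abelian structure of `P(a, b)` for `b ≤ a + 1`, proved by
truncating cones and fibres, this gives both local finiteness and locally-length. The limit lies in
the component because connected components are closed, and is unique because distance zero forces
equality. -/

namespace Stability

variable {C : Type u} [Category.{v} C] [Preadditive C] [HasZeroObject C] [HasShift C ℤ]
  [∀ n : ℤ, (shiftFunctor C n).Additive] [Pretriangulated C]

/-! ### Extensions -/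

/-- There is an exact triangle `A ⟶ X ⟶ B ⟶ A⟦1⟧`. -/
def IsExtension (A X B : C) : Prop :=
  ∃ (f : A ⟶ X) (g : X ⟶ B) (h : B ⟶ A⟦(1 : ℤ)⟧), Triangle.mk f g h ∈ distTriang C

namespace IsExtension

variable {A X B : C}

lemma of_distTriang {T : Triangle C} (hT : T ∈ distTriang C) :
    IsExtension T.obj₁ T.obj₂ T.obj₃ := ⟨T.mor₁, T.mor₂, T.mor₃, hT⟩

lemma rotate (h : IsExtension A X B) : IsExtension X B (A⟦(1 : ℤ)⟧) := by
  obtain ⟨f, g, h, hT⟩ := h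
  exact of_distTriang (rot_of_distTriang _ hT)

lemma invRotate (h : IsExtension A X B) : IsExtension (B⟦(-1 : ℤ)⟧) A X := by
  obtain ⟨f, g, h, hT⟩ := h
  exact of_distTriang (inv_rot_of_distTriang _ hT)

lemma shift (h : IsExtension A X B) (n : ℤ) : IsExtension (A⟦n⟧) (X⟦n⟧) (B⟦n⟧) := by
  obtain ⟨f, g, h, hT⟩ := h
  exact of_distTriang (Triangle.shift_distinguished _ hT n)

lemma of_iso_of_isZero (e : A ≅ X) (hB : IsZero B) : IsExtension A X B :=
  ⟨e.hom, 0, 0, (Triangle.distinguished_iff_of_isZero₃ _ hB).2 (inferInstanceAs (IsIso e.hom))⟩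

lemma of_isZero_of_iso (e : X ≅ B) (hA : IsZero A) : IsExtension A X B :=
  ⟨0, e.hom, 0, (Triangle.distinguished_iff_of_isZero₁ _ hA).2 (inferInstanceAs (IsIso e.hom))⟩

lemma biprod (A B : C) : IsExtension A (A ⊞ B) B :=
  of_distTriang (binaryBiproductTriangle_distinguished A B)

lemma congr {A' X' B' : C} (h : IsExtension A X B) (eA : A ≅ A') (eX : X ≅ X') (eB : B ≅ B') :
    IsExtension A' X' B' := by
  obtain ⟨f, g, h, hT⟩ := h
  refine ⟨eA.inv ≫ f ≫ eX.hom, eX.inv ≫ g ≫ eB.hom, eB.inv ≫ h ≫ eA.hom⟦1⟧',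
    isomorphic_distinguished _ hT _ (Triangle.isoMk _ _ eA.symm eX.symm eB.symm ?_ ?_ ?_)⟩
  · change (eA.inv ≫ f ≫ eX.hom) ≫ eX.inv = eA.inv ≫ f
    simp
  · change (eX.inv ≫ g ≫ eB.hom) ≫ eB.inv = eX.inv ≫ g
    simp
  · change (eB.inv ≫ h ≫ eA.hom⟦1⟧') ≫ eA.inv⟦1⟧' = eB.inv ≫ h
    simp only [Category.assoc, ← Functor.map_comp, Iso.hom_inv_id,
      CategoryTheory.Functor.map_id,      Category.comp_id]

lemma k0_mk (h : IsExtension A X B) : K0.mk X = K0.mk A + K0.mk B := by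
  obtain ⟨f, g, h, hT⟩ := h
  have : FreeAbelianGroup.of X - FreeAbelianGroup.of A - FreeAbelianGroup.of B ∈ K0Relations C :=
    AddSubgroup.subset_closure ⟨_, hT, rfl⟩
  rw [← QuotientAddGroup.eq_zero_iff] at this
  rw [QuotientAddGroup.mk_sub, QuotientAddGroup.mk_sub, sub_sub, sub_eq_zero] at this
  exact this

lemma nonempty_iso_left (h : IsExtension A X B) (hB : IsZero B) : Nonempty (A ≅ X) := by
  obtain ⟨f, g, h, hT⟩ := h
  have : IsIso f := (Triangle.isZero₃_iff_isIso₁ _ hT).1 hB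
  exact ⟨asIso f⟩

lemma nonempty_iso_right (h : IsExtension A X B) (hA : IsZero A) : Nonempty (X ≅ B) := by
  obtain ⟨f, g, h, hT⟩ := h
  have : IsIso g := (Triangle.isZero₁_iff_isIso₂ _ hT).1 hA
  exact ⟨asIso g⟩

variable [IsTriangulated C]

/-- The cone of a composition `A ⟶ X ⟶ W`. -/
lemma cone_comp {Y W V : C} (h₁ : IsExtension A X Y) (h₂ : IsExtension X W V) :
    ∃ Z, IsExtension A W Z ∧ IsExtension Y Z V := by
  obtain ⟨f, g, h, hT⟩ := h₁
  obtain ⟨f', g', h', hT'⟩ := h₂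
  obtain ⟨Z, p, r, hZ⟩ := distinguished_cocone_triangle (f ≫ f')
  exact ⟨Z, ⟨_, _, _, hZ⟩, ⟨_, _, _, (Triangulated.someOctahedron rfl hT hT' hZ).mem⟩⟩

/-- The fibre of a composition `X ⟶ Y ⟶ D`. -/
lemma fiber_comp {Y D : C} (h₁ : IsExtension A X Y) (h₂ : IsExtension B Y D) :
    ∃ E, IsExtension A E B ∧ IsExtension E X D := by
  obtain ⟨f, g, h, hT⟩ := h₁
  obtain ⟨f', g', h', hT'⟩ := h₂
  obtain ⟨E, p, r, hE⟩ := distinguished_cocone_triangle₁ (g ≫ g')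
  exact ⟨E, ⟨_, _, _, (Triangulated.someOctahedron' rfl hT hT' hE).mem⟩, ⟨_, _, _, hE⟩⟩

end IsExtension

/-! ### Classes in the Grothendieck group -/

lemma K0.mk_of_isZero {X : C} (hX : IsZero X) : K0.mk X = 0 := by
  have := (IsExtension.of_iso_of_isZero (Iso.refl X) hX).k0_mk
  simpa using this

lemma K0.mk_iso {X Y : C} (e : X ≅ Y) : K0.mk X = K0.mk Y := by
  have := (IsExtension.of_iso_of_isZero e (isZero_zero C)).k0_mk
  rw [this, K0.mk_of_isZero (isZero_zero C), add_zero]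

lemma K0.induction {p : K0 C → Prop} (x : K0 C) (h0 : p 0) (hmk : ∀ X : C, p (K0.mk X))
    (hneg : ∀ x, p x → p (-x)) (hadd : ∀ x y, p x → p y → p (x + y)) : p x := by
  induction x using QuotientAddGroup.induction_on with
  | H z =>
    induction z using FreeAbelianGroup.induction_on with
    | zero => exact h0
    | of X => exact hmk X
    | neg X h => exact hneg _ h
    | add x y hx hy => exact hadd _ _ hx hy

lemma K0.addHom_ext {G : Type*} [AddCommGroup G] {f g : K0 C →+ G}
    (h : ∀ X : C, f (K0.mk X) = g (K0.mk X)) : f = g := by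
  refine DFunLike.ext _ _ fun x => ?_
  refine K0.induction (p := fun x => f x = g x) x (by simp) h (fun x hx => ?_) (fun x y hx hy => ?_)
  · rw [map_neg, map_neg, hx]
  · rw [map_add, map_add, hx, hy]

/-! ### Extension closures -/

namespace ExtClosure

variable {S S' : ObjectProperty C}

lemma ofExtension {A X B : C} (h : IsExtension A X B) (hA : ExtClosure S A)
    (hB : ExtClosure S B) : ExtClosure S X := by
  obtain ⟨f, g, h, hT⟩ := h
  exact ExtClosure.ext _ hT hA hB

lemma mono (h : ∀ X, S X → ExtClosure S' X) {X : C} (hX : ExtClosure S X) : ExtClosure S' X := by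
  induction hX with
  | zero X h => exact .zero X h
  | of X hX => exact h X hX
  | iso X Y e _ ih => exact .iso X Y e ih
  | ext T hT _ _ h₁ h₂ => exact .ext T hT h₁ h₂

lemma shift (n : ℤ) (h : ∀ X, S X → ExtClosure S' (X⟦n⟧)) {X : C} (hX : ExtClosure S X) :
    ExtClosure S' (X⟦n⟧) := by
  induction hX with
  | zero X h => exact .zero _ ((shiftFunctor C n).map_isZero h)
  | of X hX => exact h X hX
  | iso X Y e _ ih => exact .iso _ _ ((shiftFunctor C n).mapIso e) ih
  | ext T hT _ _ h₁ h₂ => exact ofExtension ((IsExtension.of_distTriang hT).shift n) h₁ h₂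

lemma hom_to_eq_zero {Y : C} (h : ∀ X, S X → ∀ f : X ⟶ Y, f = 0) {X : C}
    (hX : ExtClosure S X) : ∀ f : X ⟶ Y, f = 0 := by
  induction hX with
  | zero X h => exact fun f => h.eq_of_src _ _
  | of X hX => exact h X hX
  | iso X X' e _ ih => exact fun f => by rw [← e.inv_hom_id_assoc f, ih (e.hom ≫ f), comp_zero]
  | ext T hT _ _ h₁ h₂ =>
    intro f
    obtain ⟨g, rfl⟩ := Triangle.yoneda_exact₂ T hT f (h₁ _)
    rw [h₂ g, comp_zero]

lemma hom_from_eq_zero {X : C} (h : ∀ Y, S Y → ∀ f : X ⟶ Y, f = 0) {Y : C}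
    (hY : ExtClosure S Y) : ∀ f : X ⟶ Y, f = 0 := by
  induction hY with
  | zero X h => exact fun f => h.eq_of_tgt _ _
  | of X hX => exact h X hX
  | iso Y Y' e _ ih =>
    exact fun f => by rw [← Category.comp_id f, ← e.inv_hom_id, ← Category.assoc,
      ih (f ≫ e.inv), zero_comp]
  | ext T hT _ _ h₁ h₂ =>
    intro f
    obtain ⟨g, rfl⟩ := Triangle.coyoneda_exact₂ T hT f (h₂ _)
    rw [h₁ g, zero_comp]

end ExtClosure

/-! ### Families of semistable objects -/

/-- The axioms on the subcategories `P φ` which do not involve the central charge or the existence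
of Harder--Narasimhan filtrations. -/
structure IsPreslicing (P : ℝ → ObjectProperty C) : Prop where
  iso : ∀ (φ : ℝ) {X Y : C}, (X ≅ Y) → P φ X → P φ Y
  zero : ∀ (φ : ℝ) (X : C), IsZero X → P φ X
  shift : ∀ (φ : ℝ) (X : C), P (φ + 1) X ↔ ∃ Y : C, P φ Y ∧ Nonempty (X ≅ Y⟦(1 : ℤ)⟧)
  hom_eq_zero : ∀ (φ φ' : ℝ) (X Y : C), φ' < φ → P φ X → P φ' Y → ∀ f : X ⟶ Y, f = 0

/-- The extension closure of the semistable objects with phases in `J`. -/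
def Slice (P : ℝ → ObjectProperty C) (J : Set ℝ) : ObjectProperty C :=
  ExtClosure (fun X => ∃ φ ∈ J, P φ X)

variable {P : ℝ → ObjectProperty C}

namespace Slice

lemma of {J : Set ℝ} {φ : ℝ} (hφ : φ ∈ J) {X : C} (hX : P φ X) : Slice P J X :=
  ExtClosure.of X ⟨φ, hφ, hX⟩

lemma mono {J J' : Set ℝ} (h : J ⊆ J') {X : C} (hX : Slice P J X) : Slice P J' X :=
  ExtClosure.mono (fun X ⟨φ, hφ, hX⟩ => ExtClosure.of X ⟨φ, h hφ, hX⟩) hX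

lemma ofExtension {J : Set ℝ} {A X B : C} (h : IsExtension A X B) (hA : Slice P J A)
    (hB : Slice P J B) : Slice P J X := ExtClosure.ofExtension h hA hB

lemma ofIso {J : Set ℝ} {X Y : C} (e : X ≅ Y) (hX : Slice P J X) : Slice P J Y :=
  ExtClosure.iso X Y e hX

lemma ofIsZero {J : Set ℝ} {X : C} (hX : IsZero X) : Slice P J X := ExtClosure.zero X hX

variable (hP : IsPreslicing P)
include hP

lemma hom_eq_zero {J J' : Set ℝ} {X Y : C} (hX : Slice P J X) (hY : Slice P J' Y)
    (h : ∀ φ ∈ J, ∀ φ' ∈ J', φ' < φ) (f : X ⟶ Y) : f = 0 :=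
  ExtClosure.hom_to_eq_zero (fun _ ⟨φ, hφ, hX⟩ => ExtClosure.hom_from_eq_zero
    (fun _ ⟨φ', hφ', hY⟩ => hP.hom_eq_zero φ φ' _ _ (h φ hφ φ' hφ') hX hY) hY) hX f

lemma isZero {J J' : Set ℝ} {X : C} (hX : Slice P J X) (hX' : Slice P J' X)
    (h : ∀ φ ∈ J, ∀ φ' ∈ J', φ' < φ) : IsZero X := by
  rw [IsZero.iff_id_eq_zero]
  exact hX.hom_eq_zero hP hX' h _

lemma shift {J J' : Set ℝ} (h : ∀ φ ∈ J, φ + 1 ∈ J') {X : C} (hX : Slice P J X) :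
    Slice P J' (X⟦(1 : ℤ)⟧) :=
  ExtClosure.shift 1 (fun X ⟨φ, hφ, hX⟩ =>
    ExtClosure.of _ ⟨φ + 1, h φ hφ, (hP.shift _ _).2 ⟨X, hX, ⟨Iso.refl _⟩⟩⟩) hX

lemma unshift {J J' : Set ℝ} (h : ∀ φ ∈ J, φ - 1 ∈ J') {X : C} (hX : Slice P J X) :
    Slice P J' (X⟦(-1 : ℤ)⟧) := by
  refine ExtClosure.shift (-1) (fun X ⟨φ, hφ, hX⟩ => .of _ ⟨φ - 1, h φ hφ, ?_⟩) hX
  rw [← sub_add_cancel φ 1, hP.shift] at hX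
  obtain ⟨Y, hY, ⟨e⟩⟩ := hX
  exact hP.iso _ ((shiftShiftNeg Y 1).symm ≪≫ ((shiftFunctor C (-1 : ℤ)).mapIso e).symm) hY

end Slice

/-! ### Harder--Narasimhan filtrations as lists -/

/-- `IsHN P l X` says that `X` has a Harder--Narasimhan filtration whose factors, with their
phases, are the entries of `l`, in the order of increasing phase. -/
inductive IsHN (P : ℝ → ObjectProperty C) : List (ℝ × C) → C → Prop
  | nil (X : C) : IsZero X → IsHN P [] X
  | cons {A X B : C} (φ : ℝ) (l : List (ℝ × C)) : IsExtension A X B → IsHN P l A → P φ B →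
      ¬ IsZero B → (∀ p ∈ l, φ < p.1) → IsHN P ((φ, B) :: l) X

namespace IsHN

variable {l l' : List (ℝ × C)} {X : C}

lemma ofIso {Y : C} (e : X ≅ Y) (h : IsHN P l X) : IsHN P l Y := by
  cases h with
  | nil _ hX => exact .nil _ (hX.of_iso e.symm)
  | cons φ l hext hA hB hB' hl =>
    exact .cons φ l (hext.congr (Iso.refl _) e (Iso.refl _)) hA hB hB' hl

lemma single {φ : ℝ} (hX : P φ X) (h0 : ¬ IsZero X) : IsHN P [(φ, X)] X :=
  .cons φ [] (.of_isZero_of_iso (Iso.refl X) (isZero_zero C)) (.nil _ (isZero_zero C)) hX h0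
    (by simp)

lemma mem (h : IsHN P l X) : ∀ p ∈ l, P p.1 p.2 ∧ ¬ IsZero p.2 := by
  induction h with
  | nil => simp
  | cons φ l _ _ hB hB' _ ih =>
    intro p hp
    rcases List.mem_cons.1 hp with rfl | hp
    · exact ⟨hB, hB'⟩
    · exact ih p hp

lemma slice (h : IsHN P l X) {J : Set ℝ} (hJ : ∀ p ∈ l, p.1 ∈ J) : Slice P J X := by
  induction h with
  | nil X hX => exact .ofIsZero hX
  | cons φ l hext _ hB _ _ ih =>
    exact .ofExtension hext (ih fun p hp => hJ p (List.mem_cons_of_mem _ hp))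
      (.of (hJ _ List.mem_cons_self) hB)

lemma k0_mk (h : IsHN P l X) : K0.mk X = (l.map fun p => K0.mk p.2).sum := by
  induction h with
  | nil X hX => simp [K0.mk_of_isZero hX]
  | cons φ l hext _ _ _ _ ih => rw [hext.k0_mk, ih, List.map_cons, List.sum_cons, add_comm]

lemma isZero_of_nil (h : IsHN P [] X) : IsZero X := by
  cases h with
  | nil _ hX => exact hX

lemma pairwise (h : IsHN P l X) : l.Pairwise (fun p p' => p.1 < p'.1) := by
  induction h with
  | nil => simp
  | cons φ l _ _ _ _ hl ih => exact List.pairwise_cons.2 ⟨hl, ih⟩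

/-- If the total object vanishes, the last factor `B` is isomorphic to `A⟦1⟧`, whose phases exceed
`φ + 1`, while `B` has phase `φ`. This forces `B = 0`, contrary to the nonvanishing of factors. -/
lemma eq_nil (hP : IsPreslicing P) (h : IsHN P l X) (hX : IsZero X) : l = [] := by
  cases h with
  | nil => rfl
  | @cons A _ B φ l hext hA hB hB' hl =>
    obtain ⟨e⟩ := hext.rotate.nonempty_iso_right hX
    refine absurd (Slice.isZero hP (J := Set.Ioi (φ + 1)) (J' := {φ}) ?_
      (.of (Set.mem_singleton φ) hB) ?_) hB'
    · refine .ofIso e.symm (Slice.shift hP (J := Set.Ioi φ) (fun ψ hψ => ?_) (hA.slice hl))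
      simpa using hψ
    · rintro ψ hψ _ rfl
      simp only [Set.mem_Ioi] at hψ
      linarith

/-! ### Truncation and uniqueness of Harder–Narasimhan filtrations -/

section Triangulated

variable [IsTriangulated C]

/-- Harder--Narasimhan filtrations of `B` and `A` concatenate if all the phases of the first are
smaller than those of the second. -/
lemma concat {A B : C} (hA : IsHN P l A) (hB : IsHN P l' B) (h : IsExtension A X B)
    (hl : ∀ p ∈ l', ∀ p' ∈ l, p.1 < p'.1) : IsHN P (l' ++ l) X := by
  induction hB generalizing X with
  | nil B hB =>
    obtain ⟨e⟩ := h.nonempty_iso_left hB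
    exact hA.ofIso e
  | cons φ l' hext _ hF hF' hl' ih =>
    obtain ⟨E, hE, hE'⟩ := h.fiber_comp hext
    refine .cons φ _ hE' (ih hE fun p hp p' hp' => hl p (List.mem_cons_of_mem _ hp) p' hp')
      hF hF' fun p hp => ?_
    rcases List.mem_append.1 hp with hp | hp
    · exact hl' p hp
    · exact hl _ List.mem_cons_self p hp

open scoped Classical ZeroObject in
/-- Truncation of an object at an upper set of phases. -/
lemma exists_truncation (h : IsHN P l X) {U : Set ℝ} (hU : IsUpperSet U) :
    ∃ A B, IsExtension A X B ∧ IsHN P (l.filter fun p => p.1 ∈ U) A ∧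
      IsHN P (l.filter fun p => p.1 ∉ U) B := by
  induction h with
  | nil X hX =>
    exact ⟨X, X, .of_iso_of_isZero (Iso.refl X) hX, .nil X hX, .nil X hX⟩
  | @cons A X F φ l hext hA hF hF' hl ih =>
    by_cases hφ : φ ∈ U
    · have hmem : ∀ p ∈ (φ, F) :: l, p.1 ∈ U := by
        intro p hp
        rcases List.mem_cons.1 hp with rfl | hp
        · exact hφ
        · exact hU (hl p hp).le hφ
      refine ⟨X, (0 : C), .of_iso_of_isZero (Iso.refl X) (isZero_zero C), ?_, ?_⟩
      · rw [List.filter_eq_self.2 (by simpa using hmem)]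
        exact .cons φ l hext hA hF hF' hl
      · rw [List.filter_eq_nil_iff.2 (by simpa using hmem)]
        exact .nil _ (isZero_zero C)
    · obtain ⟨A', B', hext', hA', hB'⟩ := ih
      obtain ⟨B'', h₁, h₂⟩ := hext'.cone_comp hext
      refine ⟨A', B'', h₁, ?_, ?_⟩
      · rwa [List.filter_cons_of_neg (by simpa using hφ)]
      · rw [List.filter_cons_of_pos (by simpa using hφ)]
        exact .cons φ _ h₂ hB' hF hF' fun p hp => hl p (List.mem_of_mem_filter hp)

variable (hP : IsPreslicing P)
include hP

/-- Let `A ⟶ X ⟶ B` be the truncation at `U`. By hypothesis `X ⟶ B` vanishes, so the identity of `B`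
factors through `A⟦1⟧`. The phases of `A⟦1⟧` lie in `U` and those of `B` do not, so that
factorisation is zero and `B = 0`. The hypothesis is phrased through maps so that it also applies to
bounds known only in the limit. -/
lemma mem_upper (h : IsHN P l X) {U : Set ℝ} (hU : IsUpperSet U)
    (hX : ∀ φ ∉ U, ∀ Y, P φ Y → ∀ f : X ⟶ Y, f = 0) : ∀ p ∈ l, p.1 ∈ U := by
  classical
  obtain ⟨A, B, ⟨f, g, d, hT⟩, hA, hB⟩ := h.exists_truncation hU
  have hA' : Slice P U A := hA.slice (by simp)
  have hB' : Slice P Uᶜ B := hB.slice (by simp)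
  have hg : g = 0 := ExtClosure.hom_from_eq_zero (fun Y ⟨φ, hφ, hY⟩ => hX φ hφ Y hY) hB' g
  obtain ⟨r, hr⟩ := Triangle.yoneda_exact₃ _ hT (𝟙 B) (by
    change g ≫ 𝟙 B = 0
    rw [hg, zero_comp])
  have hr0 : r = 0 := Slice.hom_eq_zero hP (hA'.shift hP fun φ hφ => hU (by simp) hφ) hB'
    (fun φ hφ φ' hφ' => by
      by_contra hlt
      exact hφ' (hU (not_lt.1 hlt) hφ)) r
  have hB0 : IsZero B := by
    rw [IsZero.iff_id_eq_zero, hr, hr0, comp_zero]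
    rfl
  have := hB.eq_nil hP hB0
  simpa using this

lemma notMem_upper (h : IsHN P l X) {U : Set ℝ} (hU : IsUpperSet U)
    (hX : ∀ φ ∈ U, ∀ Y, P φ Y → ∀ f : Y ⟶ X, f = 0) : ∀ p ∈ l, p.1 ∉ U := by
  classical
  obtain ⟨A, B, ⟨f, g, d, hT⟩, hA, hB⟩ := h.exists_truncation hU
  have hA' : Slice P U A := hA.slice (by simp)
  have hB' : Slice P Uᶜ B := hB.slice (by simp)
  have hf : f = 0 := ExtClosure.hom_to_eq_zero (fun Y ⟨φ, hφ, hY⟩ => hX φ hφ Y hY) hA' f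
  obtain ⟨r, hr⟩ := Triangle.coyoneda_exact₁ _ hT (𝟙 (A⟦(1 : ℤ)⟧)) (by
    change 𝟙 _ ≫ f⟦1⟧' = 0
    rw [hf, Functor.map_zero, comp_zero])
  have hr0 : r = 0 := Slice.hom_eq_zero hP (hA'.shift hP fun φ hφ => hU (by simp) hφ) hB'
    (fun φ hφ φ' hφ' => by
      by_contra hlt
      exact hφ' (hU (not_lt.1 hlt) hφ)) r
  have hA0 : IsZero A := by
    rw [IsZero.iff_id_eq_zero]
    apply (shiftFunctor C (1 : ℤ)).map_injective
    rw [CategoryTheory.Functor.map_id, Functor.map_zero]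
    rw [hr0] at hr
    exact hr.trans zero_comp
  have := hA.eq_nil hP hA0
  simpa using this

lemma mem_of_slice_upper (h : IsHN P l X) {U : Set ℝ} (hU : IsUpperSet U) (hX : Slice P U X) :
    ∀ p ∈ l, p.1 ∈ U :=
  h.mem_upper hP hU fun _ hφ _ hY => hX.hom_eq_zero hP (.of (J := Uᶜ) hφ hY)
    fun _ hψ _ hψ' => not_le.1 fun hle => hψ' (hU hle hψ)

lemma mem_of_slice_lower (h : IsHN P l X) {L : Set ℝ} (hL : IsLowerSet L) (hX : Slice P L X) :
    ∀ p ∈ l, p.1 ∈ L := by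
  have := h.notMem_upper hP (U := Lᶜ) hL.compl fun _ hφ _ hY =>
    (Slice.of (J := Lᶜ) hφ hY).hom_eq_zero hP hX
    fun _ hψ _ hψ' => not_le.1 fun hle => hψ (hL hle hψ')
  simpa using this

/-- The phases and the classes of the Harder--Narasimhan factors are unique. -/
lemma unique (h : IsHN P l X) (h' : IsHN P l' X) :
    l.map (fun p => (p.1, K0.mk p.2)) = l'.map (fun p => (p.1, K0.mk p.2)) := by
  induction h generalizing l' with
  | nil X hX => rw [h'.eq_nil hP hX]
  | @cons A X B φ l hext hA hB hB' hl ih =>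
    have h := IsHN.cons φ l hext hA hB hB' hl
    cases h' with
    | nil _ hX => exact absurd (h.eq_nil hP hX) (by simp)
    | @cons A' _ D φ' l' hext' hA' hD hD' hl' =>
      have h' := IsHN.cons φ' l' hext' hA' hD hD' hl'
      have hφ : φ = φ' := by
        apply le_antisymm
        · refine h'.mem_of_slice_upper hP (isUpperSet_Ici φ) (h.slice ?_) (φ', D) (by simp)
          simpa using fun p q hpq => (hl _ hpq).le
        · refine h.mem_of_slice_upper hP (isUpperSet_Ici φ') (h'.slice ?_) (φ, B) (by simp)
          simpa using fun p q hpq => (hl' _ hpq).le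
      subst hφ
      have sA : Slice P (Set.Ioi φ) A := hA.slice hl
      have sA' : Slice P (Set.Ioi φ) A' := hA'.slice hl'
      obtain ⟨f, g, d, hT⟩ := hext
      obtain ⟨f', g', d', hT'⟩ := hext'
      -- `A` has phases above `φ` and `D` has phase `φ`, so `A ⟶ X` factors through `A'`. The
      -- octahedron identifies the cone `E` of this factorisation with the fibre of a map `B ⟶ D`.
      -- Its phases are `> φ` seen from `A'` and `A⟦1⟧`, and `≤ φ` seen from `B` and `D⟦-1⟧`; hence
      -- `E = 0`.
      obtain ⟨a, ha⟩ := Triangle.coyoneda_exact₂ _ hT' f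
        (sA.hom_eq_zero hP (.of (J := {φ}) (Set.mem_singleton φ) hD) (by simp) _)
      obtain ⟨E, p, r, hE⟩ := distinguished_cocone_triangle a
      have o := (Triangulated.someOctahedron ha.symm hE hT' hT).mem
      have e₁ : IsExtension A A' E := ⟨_, _, _, hE⟩
      have e₂ : IsExtension E B D := ⟨_, _, _, o⟩
      have sE : Slice P (Set.Ioi φ) E := .ofExtension e₁.rotate sA'
        (sA.shift hP fun ψ hψ => by
          simp only [Set.mem_Ioi] at hψ ⊢
          linarith)
      have sE' : Slice P (Set.Iic φ) E := .ofExtension e₂.invRotate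
        (Slice.unshift hP (J := {φ}) (by simp) (.of (Set.mem_singleton φ) hD)) (.of (by simp) hB)
      have hE0 : IsZero E := sE.isZero hP sE' fun ψ hψ ψ' hψ' => lt_of_le_of_lt hψ' hψ
      obtain ⟨e⟩ := e₁.nonempty_iso_left hE0
      obtain ⟨e'⟩ := e₂.nonempty_iso_right hE0
      rw [List.map_cons, List.map_cons, K0.mk_iso e', ih (hA'.ofIso e.symm)]

end Triangulated

end IsHN

end Stability

namespace Stability

variable {C : Type u} [Category.{v} C] [Preadditive C] [HasZeroObject C] [HasShift C ℤ]
  [∀ n : ℤ, (shiftFunctor C n).Additive] [Pretriangulated C]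

variable {P : ℝ → ObjectProperty C}

/-! ### Comparison of the two forms of Harder--Narasimhan filtrations -/

/-- The phases and factors of a Harder--Narasimhan filtration, by increasing phase. -/
def HNFiltration.toList {X : C} (F : HNFiltration P X) : List (ℝ × C) :=
  (List.ofFn fun i => (F.phase i, F.factor i)).reverse

lemma HNFiltration.mem_toList {X : C} (F : HNFiltration P X) {p : ℝ × C} :
    p ∈ F.toList ↔ ∃ i, (F.phase i, F.factor i) = p := by
  rw [HNFiltration.toList, List.mem_reverse]
  exact List.mem_ofFn' _ _

lemma HNFiltration.isHN {X : C} (F : HNFiltration P X) : IsHN P F.toList X := by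
  -- Induction on initial segments: `obj k` is filtered by the first `k` factors. The list is
  -- reversed because `IsHN` puts the outermost factor, of smallest phase, at the head.
  have key : ∀ (k : ℕ) (hk : k ≤ F.n + 1),
      IsHN P (List.ofFn fun i : Fin k => (F.phase (i.castLE hk), F.factor (i.castLE hk))).reverse
        (F.obj ⟨k, by omega⟩) := by
    intro k
    induction k with
    | zero => exact fun hk => .nil _ F.isZero_obj_zero
    | succ k ih =>
      intro hk
      rw [List.ofFn_succ', List.concat_eq_append, List.reverse_append, List.reverse_singleton,
        List.singleton_append]
      refine .cons _ _ ⟨_, _, _, F.triangle_mem ⟨k, hk⟩⟩ (ih (by omega)) (F.factor_mem _)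
        (F.factor_not_isZero _) fun p hp => ?_
      obtain ⟨i, rfl⟩ := (List.mem_ofFn' _ _).1 (List.mem_reverse.1 hp)
      exact F.phase_strictAnti i.castSucc_lt_last
  exact (key (F.n + 1) le_rfl).ofIso F.topIso

lemma IsHN.exists_sequence {l : List (ℝ × C)} {X : C} (h : IsHN P l X) :
    ∃ o : ℕ → C, IsZero (o 0) ∧ o l.length = X ∧
      ∀ (i : ℕ) (hi : i < l.reverse.length), IsExtension (o i) (o (i + 1)) (l.reverse[i]).2 := by
  induction h with
  | nil X hX => exact ⟨fun _ => X, hX, rfl, by simp⟩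
  | @cons A X B φ l hext _ _ _ _ ih =>
    obtain ⟨o, h0, h1, ho⟩ := ih
    -- Only the value at `l.length + 1` is new; using a total function on `ℕ` avoids dependent
    -- indices.
    refine ⟨fun k => if k ≤ l.length then o k else X, by simpa using h0, by simp, fun i hi => ?_⟩
    simp only [List.reverse_cons, List.length_append, List.length_reverse, List.length_singleton]
      at hi
    rcases (Nat.lt_succ_iff.1 hi).lt_or_eq with hi' | rfl
    · simpa [hi'.le, Nat.succ_le_of_lt hi', List.getElem_append_left, hi'] using
        ho i (by simpa using hi')
    · simpa [h1] using hext

lemma IsHN.nonempty_hnFiltration {l : List (ℝ × C)} {X : C} (h : IsHN P l X)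
    (hX : ¬ IsZero X) : Nonempty (HNFiltration P X) := by
  obtain ⟨o, h0, h1, ho⟩ := h.exists_sequence
  obtain ⟨n, hn⟩ : ∃ n, l.reverse.length = n + 1 := by
    refine Nat.exists_eq_succ_of_ne_zero fun h' => hX ?_
    rw [List.length_reverse] at h'
    rwa [← h1, h']
  have hlt : ∀ i : Fin (n + 1), (i : ℕ) < l.reverse.length := fun i => i.2.trans_eq hn.symm
  choose f g d hT using fun i : Fin (n + 1) => ho i (hlt i)
  have hmem : ∀ i : Fin (n + 1), P (l.reverse[i.1]'(hlt i)).1 (l.reverse[i.1]'(hlt i)).2 ∧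
      ¬ IsZero (l.reverse[i.1]'(hlt i)).2 :=
    fun i => h.mem _ (List.mem_reverse.1 (List.getElem_mem _))
  exact ⟨{
    n := n
    obj := fun i => o i
    factor := fun i => (l.reverse[i.1]'(hlt i)).2
    phase := fun i => (l.reverse[i.1]'(hlt i)).1
    ι := f
    π := g
    δ := d
    triangle_mem := hT
    isZero_obj_zero := h0
    topIso := eqToIso (by rw [← h1, ← List.length_reverse, hn]; rfl)
    phase_strictAnti := fun i j hij =>
      List.pairwise_iff_getElem.1 (List.pairwise_reverse.2 h.pairwise) i j _ _ hij
    factor_mem := fun i => (hmem i).1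
    factor_not_isZero := fun i => (hmem i).2 }⟩

lemma IsHN.ne_nil {l : List (ℝ × C)} {X : C} (h : IsHN P l X) (hX : ¬ IsZero X) : l ≠ [] := by
  rintro rfl
  exact hX h.isZero_of_nil

section

variable [IsTriangulated C]

lemma IsHN.mem_of_slice (hP : IsPreslicing P) {l : List (ℝ × C)} {X : C} (h : IsHN P l X)
    {J : Set ℝ} (hJ : J.OrdConnected) (hX : Slice P J X) : ∀ p ∈ l, p.1 ∈ J := by
  intro p hp
  obtain ⟨a, ha, hap⟩ := h.mem_of_slice_upper hP (upperClosure J).upper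
    (hX.mono subset_upperClosure) p hp
  obtain ⟨b, hb, hpb⟩ := h.mem_of_slice_lower hP (lowerClosure J).lower
    (hX.mono subset_lowerClosure) p hp
  exact hJ.out ha hb ⟨hap, hpb⟩

lemma IsHN.mem_iff (hP : IsPreslicing P) {l l' : List (ℝ × C)} {X : C} (h : IsHN P l X)
    (h' : IsHN P l' X) (φ : ℝ) : (∃ p ∈ l, p.1 = φ) ↔ ∃ p ∈ l', p.1 = φ := by
  have := congrArg (List.map Prod.fst) (h.unique hP h')
  rw [List.map_map, List.map_map] at this
  simpa using congrArg (φ ∈ ·) this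

end

/-- All phases in the filtration equal `φ`, and phases are strictly monotone, so there is at most
one factor. In particular `P φ` is closed under extensions when filtrations exist. -/
lemma IsPreslicing.of_slice_singleton (hP : IsPreslicing P) [IsTriangulated C]
    {l : List (ℝ × C)} {X : C} (h : IsHN P l X) {φ : ℝ} (hX : Slice P {φ} X) : P φ X := by
  have hl := h.mem_of_slice hP Set.ordConnected_singleton hX
  cases h with
  | nil _ hX => exact hP.zero _ _ hX
  | cons ψ l hext hA hB hB' hψ =>
    have h1 : ψ = φ := hl _ List.mem_cons_self
    subst h1
    cases l with
    | nil =>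
      obtain ⟨e⟩ := hext.nonempty_iso_right hA.isZero_of_nil
      exact hP.iso _ e.symm hB
    | cons q l =>
      exact absurd (hψ q List.mem_cons_self) (by
        rw [show q.1 = ψ from hl q (List.mem_cons_of_mem _ List.mem_cons_self)]
        exact lt_irrefl _)

/-! ### Phases and masses -/

namespace StabilityCondition

variable (σ : StabilityCondition C)

lemma isPreslicing : IsPreslicing σ.P :=
  ⟨σ.P_iso, σ.P_zero, σ.P_shift, σ.hom_eq_zero⟩

lemma exists_isHN (X : C) : ∃ l, IsHN σ.P l X := by
  by_cases hX : IsZero X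
  · exact ⟨[], .nil X hX⟩
  · exact ⟨_, (σ.hn X hX).isHN⟩

lemma mass_of_isZero {X : C} (hX : IsZero X) : σ.mass X = 0 := dif_pos hX

lemma phase_mem_Icc {X : C} (hX : ¬ IsZero X) {p : ℝ × C} (hp : p ∈ (σ.hn X hX).toList) :
    p.1 ∈ Set.Icc (σ.phiMinus X) (σ.phiPlus X) := by
  obtain ⟨i, rfl⟩ := (σ.hn X hX).mem_toList.1 hp
  rw [phiMinus, phiPlus, dif_neg hX, dif_neg hX]
  exact ⟨(σ.hn X hX).phase_strictAnti.antitone (Fin.le_last i),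
    (σ.hn X hX).phase_strictAnti.antitone (Fin.zero_le i)⟩

variable [IsTriangulated C]

variable {σ} {X : C} {l : List (ℝ × C)}

/-- Mass depends only on the classes of the factors, which are unique, so the chosen filtration in
`mass` may be replaced by any other. -/
lemma _root_.Stability.IsHN.mass_eq (h : IsHN σ.P l X) :
    σ.mass X = (l.map fun p => ‖σ.Z (K0.mk p.2)‖).sum := by
  by_cases hX : IsZero X
  · rw [σ.mass_of_isZero hX, h.eq_nil σ.isPreslicing hX]
    rfl
  · have h1 := congrArg (List.map fun q : ℝ × K0 C => ‖σ.Z q.2‖)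
      (h.unique σ.isPreslicing (σ.hn X hX).isHN)
    rw [List.map_map, List.map_map] at h1
    have h2 := congrArg List.sum h1
    rw [HNFiltration.toList, List.map_reverse, List.sum_reverse, List.map_ofFn,
      List.sum_ofFn] at h2
    rw [mass, dif_neg hX]
    exact h2.symm

lemma _root_.Stability.IsHN.phase_mem_Icc (h : IsHN σ.P l X) {p : ℝ × C} (hp : p ∈ l) :
    p.1 ∈ Set.Icc (σ.phiMinus X) (σ.phiPlus X) := by
  have hX : ¬ IsZero X := fun hX => by simp [h.eq_nil σ.isPreslicing hX] at hp
  obtain ⟨q, hq, hqp⟩ := (h.mem_iff σ.isPreslicing (σ.hn X hX).isHN p.1).1 ⟨p, hp, rfl⟩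
  exact hqp ▸ σ.phase_mem_Icc hX hq

lemma _root_.Stability.IsHN.exists_phiMinus (h : IsHN σ.P l X) (hX : ¬ IsZero X) :
    ∃ p ∈ l, p.1 = σ.phiMinus X := by
  refine (h.mem_iff σ.isPreslicing (σ.hn X hX).isHN _).2 ⟨_, HNFiltration.mem_toList _ |>.2
    ⟨Fin.last _, rfl⟩, ?_⟩
  rw [phiMinus, dif_neg hX]

lemma _root_.Stability.IsHN.exists_phiPlus (h : IsHN σ.P l X) (hX : ¬ IsZero X) :
    ∃ p ∈ l, p.1 = σ.phiPlus X := by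
  refine (h.mem_iff σ.isPreslicing (σ.hn X hX).isHN _).2 ⟨_, HNFiltration.mem_toList _ |>.2
    ⟨0, rfl⟩, ?_⟩
  rw [phiPlus, dif_neg hX]

lemma phiMinus_le_phiPlus (hX : ¬ IsZero X) : σ.phiMinus X ≤ σ.phiPlus X := by
  obtain ⟨p, hp, h⟩ := (σ.hn X hX).isHN.exists_phiMinus hX
  exact h ▸ ((σ.hn X hX).isHN.phase_mem_Icc hp).2

/-- Trades bounds on the extreme phases for membership in an extension closure, which is visibly
stable under extensions and shifts. -/
lemma slice_iff (hX : ¬ IsZero X) {J : Set ℝ} (hJ : J.OrdConnected) :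
    Slice σ.P J X ↔ σ.phiMinus X ∈ J ∧ σ.phiPlus X ∈ J := by
  have h := (σ.hn X hX).isHN
  constructor
  · intro hs
    have hm := h.mem_of_slice σ.isPreslicing hJ hs
    obtain ⟨p, hp, hp'⟩ := h.exists_phiMinus hX
    obtain ⟨q, hq, hq'⟩ := h.exists_phiPlus hX
    exact ⟨hp' ▸ hm p hp, hq' ▸ hm q hq⟩
  · rintro ⟨h1, h2⟩
    exact h.slice fun p hp => hJ.out h1 h2 (h.phase_mem_Icc hp)

lemma slice_Ioo_iff (hX : ¬ IsZero X) {a b : ℝ} :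
    Slice σ.P (Set.Ioo a b) X ↔ a < σ.phiMinus X ∧ σ.phiPlus X < b := by
  have := phiMinus_le_phiPlus (σ := σ) hX
  rw [slice_iff hX Set.ordConnected_Ioo, Set.mem_Ioo, Set.mem_Ioo]
  exact ⟨fun h => ⟨h.1.1, h.2.2⟩, fun h => ⟨⟨h.1, by linarith⟩, by linarith, h.2⟩⟩

lemma slice_Iio_iff (hX : ¬ IsZero X) {b : ℝ} :
    Slice σ.P (Set.Iio b) X ↔ σ.phiPlus X < b := by
  rw [slice_iff hX Set.ordConnected_Iio]
  exact ⟨fun h => h.2, fun h => ⟨(phiMinus_le_phiPlus hX).trans_lt h, h⟩⟩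

lemma slice_Ioi_iff (hX : ¬ IsZero X) {a : ℝ} :
    Slice σ.P (Set.Ioi a) X ↔ a < σ.phiMinus X := by
  rw [slice_iff hX Set.ordConnected_Ioi]
  exact ⟨fun h => h.1, fun h => ⟨h, lt_of_lt_of_le h (phiMinus_le_phiPlus hX)⟩⟩

lemma semistable_iff (hX : ¬ IsZero X) {φ : ℝ} :
    σ.P φ X ↔ σ.phiMinus X = φ ∧ σ.phiPlus X = φ := by
  rw [← Set.mem_singleton_iff (a := σ.phiMinus X), ← Set.mem_singleton_iff (a := σ.phiPlus X),
    ← slice_iff hX Set.ordConnected_singleton]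
  exact ⟨fun h => .of (Set.mem_singleton φ) h, σ.isPreslicing.of_slice_singleton (σ.hn X hX).isHN⟩

/-- When the phases of `A` all lie above those of `B`, their Harder–Narasimhan filtrations
concatenate to one of `X`. -/
lemma mass_eq_add {A B : C} (h : IsExtension A X B) {J J' : Set ℝ} (hJ : J.OrdConnected)
    (hJ' : J'.OrdConnected) (hA : Slice σ.P J A) (hB : Slice σ.P J' B)
    (hlt : ∀ φ ∈ J, ∀ φ' ∈ J', φ' < φ) : σ.mass X = σ.mass A + σ.mass B := by
  obtain ⟨l, hl⟩ := σ.exists_isHN A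
  obtain ⟨l', hl'⟩ := σ.exists_isHN B
  rw [(hl.concat hl' h fun p hp q hq => hlt _ (hl.mem_of_slice σ.isPreslicing hJ hA q hq) _
    (hl'.mem_of_slice σ.isPreslicing hJ' hB p hp)).mass_eq, hl.mass_eq, hl'.mass_eq,
    List.map_append, List.sum_append, add_comm]

lemma mass_semistable {φ : ℝ} (hX : σ.P φ X) : σ.mass X = ‖σ.Z (K0.mk X)‖ := by
  by_cases h0 : IsZero X
  · rw [σ.mass_of_isZero h0, K0.mk_of_isZero h0, map_zero, norm_zero]
  · rw [(IsHN.single hX h0).mass_eq]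
    simp

variable (σ X) in
lemma norm_charge_le_mass : ‖σ.Z (K0.mk X)‖ ≤ σ.mass X := by
  obtain ⟨l, hl⟩ := σ.exists_isHN X
  rw [hl.k0_mk, hl.mass_eq, map_list_sum, List.map_map]
  generalize l = l
  induction l with
  | nil => simp
  | cons p l ih =>
    rw [List.map_cons, List.map_cons, List.sum_cons, List.sum_cons]
    exact (norm_add_le _ _).trans (add_le_add le_rfl ih)

lemma charge_eq {φ : ℝ} (hX : σ.P φ X) :
    σ.Z (K0.mk X) = σ.mass X * Complex.exp (Complex.I * Real.pi * φ) := by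
  by_cases h0 : IsZero X
  · rw [σ.mass_of_isZero h0, K0.mk_of_isZero h0, map_zero, Complex.ofReal_zero, zero_mul]
  · obtain ⟨m, hm, h⟩ := σ.charge φ X hX h0
    rw [mass_semistable hX, h, norm_mul, show Complex.I * Real.pi * φ =
      ((Real.pi * φ : ℝ) : ℂ) * Complex.I by push_cast; ring, Complex.norm_exp_ofReal_mul_I,
      mul_one, Complex.norm_real, Real.norm_of_nonneg hm.le]

/-- The charge of an object whose phases are close to `θ` is close to its mass times
`exp (iπθ)`. -/
lemma norm_charge_sub_le {θ ε : ℝ} (hX : Slice σ.P (Set.Ioo (θ - ε) (θ + ε)) X) :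
    ‖σ.Z (K0.mk X) - σ.mass X * Complex.exp (Complex.I * Real.pi * θ)‖ ≤
      σ.mass X * (Real.pi * ε) := by
  obtain ⟨l, hl⟩ := σ.exists_isHN X
  have hm := hl.mem_of_slice σ.isPreslicing Set.ordConnected_Ioo hX
  have key : ∀ l : List (ℝ × C), (∀ p ∈ l, σ.P p.1 p.2) →
      (∀ p ∈ l, p.1 ∈ Set.Ioo (θ - ε) (θ + ε)) →
      ‖(l.map fun p => σ.Z (K0.mk p.2)).sum - ((l.map fun p => σ.mass p.2).sum : ℝ) *
        Complex.exp (Complex.I * Real.pi * θ)‖ ≤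
      (l.map fun p => σ.mass p.2).sum * (Real.pi * ε) := by
    intro l
    induction l with
    | nil => simp
    | cons p l ih =>
      intro h1 h2
      have ih := ih (fun q hq => h1 q (List.mem_cons_of_mem _ hq))
        (fun q hq => h2 q (List.mem_cons_of_mem _ hq))
      have hp := h2 p List.mem_cons_self
      have hmass : 0 ≤ σ.mass p.2 := by
        rw [mass_semistable (h1 p List.mem_cons_self)]
        exact norm_nonneg _
      have hexp : ‖Complex.exp (Complex.I * Real.pi * p.1) -
          Complex.exp (Complex.I * Real.pi * θ)‖ ≤ Real.pi * ε := by
        have h3 : Complex.exp (Complex.I * Real.pi * p.1) -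
            Complex.exp (Complex.I * Real.pi * θ) =
            Complex.exp (((Real.pi * θ : ℝ) : ℂ) * Complex.I) *
              (Complex.exp (Complex.I * ((Real.pi * (p.1 - θ) : ℝ) : ℂ)) - 1) := by
          rw [mul_sub, ← Complex.exp_add, mul_one]
          push_cast
          ring_nf
        rw [h3, norm_mul, Complex.norm_exp_ofReal_mul_I, one_mul]
        refine (Real.norm_exp_I_mul_ofReal_sub_one_le).trans ?_
        rw [norm_mul, Real.norm_of_nonneg Real.pi_pos.le, Real.norm_eq_abs]
        refine mul_le_mul_of_nonneg_left (abs_le.2 ⟨?_, ?_⟩) Real.pi_pos.le <;>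
          linarith [hp.1, hp.2]
      simp only [List.map_cons, List.sum_cons, Complex.ofReal_add, add_mul]
      rw [add_sub_add_comm]
      refine (norm_add_le _ _).trans (add_le_add ?_ ih)
      rw [charge_eq (h1 p List.mem_cons_self), ← mul_sub, norm_mul, Complex.norm_real,
        Real.norm_of_nonneg hmass]
      exact mul_le_mul_of_nonneg_left hexp hmass
  have hmass : σ.mass X = (l.map fun p => σ.mass p.2).sum := by
    rw [hl.mass_eq]
    exact congrArg _ (List.map_congr_left fun p hp => (mass_semistable (hl.mem p hp).1).symm)
  have := key l (fun p hp => (hl.mem p hp).1) hm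
  rwa [← hmass, show (l.map fun p => σ.Z (K0.mk p.2)).sum = σ.Z (K0.mk X) by
    rw [hl.k0_mk, map_list_sum, List.map_map]; rfl] at this

lemma mass_nonneg (X : C) : 0 ≤ σ.mass X := (norm_nonneg _).trans (σ.norm_charge_le_mass X)

lemma length_mul_le_mass (h : IsHN σ.P l X) {δ : ℝ}
    (hδ : ∀ (φ : ℝ) (E : C), σ.P φ E → ¬ IsZero E → δ ≤ ‖σ.Z (K0.mk E)‖) :
    l.length * δ ≤ σ.mass X := by
  rw [h.mass_eq, ← nsmul_eq_mul, ← List.length_map (as := l) (fun p => ‖σ.Z (K0.mk p.2)‖)]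
  refine List.card_nsmul_le_sum _ _ fun x hx => ?_
  obtain ⟨p, hp, rfl⟩ := List.mem_map.1 hx
  exact hδ p.1 p.2 (h.mem p hp).1 (h.mem p hp).2

lemma le_mass {δ : ℝ} (hδ0 : 0 ≤ δ)
    (hδ : ∀ (φ : ℝ) (E : C), σ.P φ E → ¬ IsZero E → δ ≤ ‖σ.Z (K0.mk E)‖) (hX : ¬ IsZero X) :
    δ ≤ σ.mass X := by
  obtain ⟨l, hl⟩ := σ.exists_isHN X
  refine le_trans ?_ (length_mul_le_mass hl hδ)
  have : (1 : ℝ) ≤ l.length := by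
    exact_mod_cast List.length_pos_iff.2 (hl.ne_nil hX)
  nlinarith

end StabilityCondition

end Stability

namespace Stability

variable {C : Type u} [Category.{v} C] [Preadditive C] [HasZeroObject C] [HasShift C ℤ]
  [∀ n : ℤ, (shiftFunctor C n).Additive] [Pretriangulated C] [IsTriangulated C]

/-! ### Limits of Cauchy sequences of stability conditions -/

/-- Finitely many reals which are widely spread leave a large gap. -/
lemma exists_gap (F : Finset ℝ) {k : ℕ} (hk : F.card ≤ k) {x y g : ℝ} (hg : 0 ≤ g)
    (hx : x ∈ F) (hxy : x + k * g < y) :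
    ∃ s, x ≤ s ∧ s + g < y ∧ ∀ z ∈ F, s < z → s + g < z := by
  by_contra! hcon
  -- Without a gap, each of the `k` disjoint windows `(x + j g, x + (j + 1) g]` contains a point of
  -- `F`. Together with `x` these are `k + 1` points.
  have hpick : ∀ j ∈ Finset.range k, ∃ z ∈ F.erase x, x + j * g < z ∧ z ≤ x + (j + 1) * g := by
    intro j hj
    have hjk : (j : ℝ) + 1 ≤ k := by exact_mod_cast Finset.mem_range.1 hj
    have h0 : 0 ≤ (j : ℝ) * g := by positivity
    obtain ⟨z, hz, h1, h2⟩ := hcon (x + j * g) (by linarith) (by nlinarith)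
    exact ⟨z, Finset.mem_erase.2 ⟨by linarith, hz⟩, h1, by linarith⟩
  choose! f hf hf1 hf2 using hpick
  have hinj : Set.InjOn f (Finset.range k) := by
    have hlt : ∀ i ∈ Finset.range k, ∀ j ∈ Finset.range k, i < j → f i < f j := by
      intro i hi j hj hij
      refine (hf2 i hi).trans_lt (lt_of_le_of_lt ?_ (hf1 j hj))
      have : (i : ℝ) + 1 ≤ j := by exact_mod_cast hij
      nlinarith
    intro i hi j hj hij
    rcases lt_trichotomy i j with h | h | h
    · exact absurd hij (hlt i hi j hj h).ne
    · exact h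
    · exact absurd hij (hlt j hj i hi h).ne'
  have h1 := Finset.card_le_card_of_injOn f hf hinj
  rw [Finset.card_range, Finset.card_erase_of_mem hx] at h1
  have := Finset.card_pos.2 ⟨x, hx⟩
  omega

open StabilityCondition

variable {σ : ℕ → StabilityCondition C}

/-- The right-hand condition is already closed under extensions, so generating adds only zero
objects to the class of objects whose phases tend to `θ`. -/
lemma limitingSemistable_iff {θ : ℝ} {X : C} :
    limitingSemistable σ θ X ↔
      ∀ ε > 0, ∀ᶠ n in atTop, Slice (σ n).P (Set.Ioo (θ - ε) (θ + ε)) X := by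
  constructor
  · intro h ε hε
    induction h with
    | zero X hX => exact Eventually.of_forall fun n => .ofIsZero hX
    | of X hX =>
      obtain ⟨h0, h1, h2⟩ := hX
      filter_upwards [h1.eventually_lt_const (lt_add_of_pos_right θ hε),
        h2.eventually_const_lt (sub_lt_self θ hε)] with n h3 h4
      exact (slice_Ioo_iff h0).2 ⟨h4, h3⟩
    | iso X Y e _ ih => exact ih.mono fun n h => h.ofIso e
    | ext T hT _ _ h1 h2 =>
      filter_upwards [h1, h2] with n h3 h4
      exact .ofExtension (.of_distTriang hT) h3 h4
  · intro h
    by_cases h0 : IsZero X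
    · exact .zero X h0
    · have hle := fun n => phiMinus_le_phiPlus (σ := σ n) h0
      have h' : ∀ ε > 0, ∀ᶠ n in atTop, θ - ε < (σ n).phiMinus X ∧ (σ n).phiPlus X < θ + ε :=
        fun ε hε => (h ε hε).mono fun n hn => (slice_Ioo_iff h0).1 hn
      refine .of X ⟨h0, tendsto_order.2 ⟨fun a ha => ?_, fun b hb => ?_⟩,
        tendsto_order.2 ⟨fun a ha => ?_, fun b hb => ?_⟩⟩
      · exact (h' (θ - a) (by linarith)).mono fun n hn => by linarith [hn.1, hle n]
      · exact (h' (b - θ) (by linarith)).mono fun n hn => by linarith [hn.2]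
      · exact (h' (θ - a) (by linarith)).mono fun n hn => by linarith [hn.1]
      · exact (h' (b - θ) (by linarith)).mono fun n hn => by linarith [hn.2, hle n]

namespace limitingSemistable

lemma eventually_slice_Iio {θ b : ℝ} {X : C} (h : limitingSemistable σ θ X) (hb : θ < b) :
    ∀ᶠ n in atTop, Slice (σ n).P (Set.Iio b) X :=
  (limitingSemistable_iff.1 h (b - θ) (sub_pos.2 hb)).mono fun _ hn => hn.mono fun x hx => by
    simpa using hx.2

lemma eventually_slice_Ioi {θ a : ℝ} {X : C} (h : limitingSemistable σ θ X) (ha : a < θ) :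
    ∀ᶠ n in atTop, Slice (σ n).P (Set.Ioi a) X :=
  (limitingSemistable_iff.1 h (θ - a) (sub_pos.2 ha)).mono fun _ hn => hn.mono fun x hx => by
    simpa using hx.1

end limitingSemistable

-- Vanishing of a map can be tested at a single index where both eventual conditions hold.
omit [IsTriangulated C] in
lemma eventually_eq_zero_of_slice {X Y : C} {a : ℝ}
    (hX : ∀ᶠ n in atTop, Slice (σ n).P (Set.Ioi a) X)
    (hY : ∀ᶠ n in atTop, Slice (σ n).P (Set.Iio a) Y) (f : X ⟶ Y) : f = 0 := by
  obtain ⟨n, h1, h2⟩ := (hX.and hY).exists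
  exact h1.hom_eq_zero (σ n).isPreslicing h2 (fun φ hφ φ' hφ' => lt_trans hφ' hφ) f

variable (σ) in
lemma isPreslicing_limitingSemistable : IsPreslicing (limitingSemistable σ) where
  iso φ _ _ e h := .iso _ _ e h
  zero φ X hX := .zero X hX
  shift φ X := by
    constructor
    · intro h
      refine ⟨X⟦(-1 : ℤ)⟧, limitingSemistable_iff.2 fun ε hε => ?_,
        ⟨(shiftNegShift X (1 : ℤ)).symm⟩⟩
      refine (limitingSemistable_iff.1 h ε hε).mono fun n hn =>
        hn.unshift (σ n).isPreslicing fun ψ hψ => ?_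
      simp only [Set.mem_Ioo] at hψ ⊢
      constructor <;> linarith
    · rintro ⟨Y, hY, ⟨e⟩⟩
      refine .iso _ _ e.symm (limitingSemistable_iff.2 fun ε hε => ?_)
      refine (limitingSemistable_iff.1 hY ε hε).mono fun n hn =>
        hn.shift (σ n).isPreslicing fun ψ hψ => ?_
      simp only [Set.mem_Ioo] at hψ ⊢
      constructor <;> linarith
  hom_eq_zero φ φ' X Y h hX hY f :=
    eventually_eq_zero_of_slice (a := (φ + φ') / 2) (hX.eventually_slice_Ioi (by linarith))
      (hY.eventually_slice_Iio (by linarith)) f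

/-! ### Filtrations by limiting semistable objects -/

namespace IsHN

variable {l : List (ℝ × C)} {X : C}

/-- A limiting semistable object of phase below `a` eventually has all its phases below `a`, so it
receives no nonzero map from `X`. Strict bounds along the sequence become weak ones in the limit. -/
lemma le_of_eventually_slice (h : IsHN (limitingSemistable σ) l X) {a : ℝ}
    (hX : ∀ᶠ n in atTop, Slice (σ n).P (Set.Ioi a) X) : ∀ p ∈ l, a ≤ p.1 :=
  h.mem_upper (isPreslicing_limitingSemistable σ) (isUpperSet_Ici a) fun _ hφ _ hY f =>
    eventually_eq_zero_of_slice hX (hY.eventually_slice_Iio (not_le.1 hφ)) f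

lemma ge_of_eventually_slice (h : IsHN (limitingSemistable σ) l X) {b : ℝ}
    (hX : ∀ᶠ n in atTop, Slice (σ n).P (Set.Iio b) X) : ∀ p ∈ l, p.1 ≤ b := by
  have := h.notMem_upper (isPreslicing_limitingSemistable σ) (isUpperSet_Ioi b)
    fun _ hφ _ hY f => eventually_eq_zero_of_slice (hY.eventually_slice_Ioi hφ) hX f
  simpa using this

lemma eventually_slice_Iio (h : IsHN (limitingSemistable σ) l X) {b : ℝ}
    (hb : ∀ p ∈ l, p.1 < b) : ∀ᶠ n in atTop, Slice (σ n).P (Set.Iio b) X := by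
  induction h with
  | nil X hX => exact Eventually.of_forall fun n => .ofIsZero hX
  | cons φ l hext _ hB _ _ ih =>
    filter_upwards [ih fun p hp => hb p (List.mem_cons_of_mem _ hp),
      hB.eventually_slice_Iio (hb _ List.mem_cons_self)] with n h1 h2
    exact .ofExtension hext h1 h2

lemma eventually_slice_Ioi (h : IsHN (limitingSemistable σ) l X) {a : ℝ}
    (ha : ∀ p ∈ l, a < p.1) : ∀ᶠ n in atTop, Slice (σ n).P (Set.Ioi a) X := by
  induction h with
  | nil X hX => exact Eventually.of_forall fun n => .ofIsZero hX
  | cons φ l hext _ hB _ _ ih =>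
    filter_upwards [ih fun p hp => ha p (List.mem_cons_of_mem _ hp),
      hB.eventually_slice_Ioi (ha _ List.mem_cons_self)] with n h1 h2
    exact .ofExtension hext h1 h2

lemma eventually_mass_eq (h : IsHN (limitingSemistable σ) l X) :
    ∀ᶠ n in atTop, (σ n).mass X = (l.map fun p => (σ n).mass p.2).sum := by
  induction h with
  | nil X hX => exact Eventually.of_forall fun n => (σ n).mass_of_isZero hX
  | cons φ l hext hA hB _ hl ih =>
    -- A cut strictly between `φ` and the finitely many larger phases: for large `n` the phases of
    -- `A` and `B` lie on opposite sides of `c`, so masses add.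
    obtain ⟨c, hc, hc'⟩ : ∃ c, φ < c ∧ ∀ p ∈ l, c < p.1 := by
      clear ih hA
      induction l with
      | nil => exact ⟨φ + 1, by linarith, by simp⟩
      | cons p l ih =>
        obtain ⟨c, h1, h2⟩ := ih fun q hq => hl q (List.mem_cons_of_mem _ hq)
        have hp := hl p List.mem_cons_self
        refine ⟨min c ((φ + p.1) / 2), lt_min h1 (by linarith), fun q hq => ?_⟩
        rcases List.mem_cons.1 hq with rfl | hq
        · exact (min_le_right _ _).trans_lt (by linarith)
        · exact (min_le_left _ _).trans_lt (h2 q hq)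
    filter_upwards [ih, hA.eventually_slice_Ioi hc', hB.eventually_slice_Iio hc] with n h1 h2 h3
    rw [mass_eq_add hext Set.ordConnected_Ioi Set.ordConnected_Iio h2 h3
      (fun φ hφ φ' hφ' => lt_trans hφ' hφ), h1, List.map_cons, List.sum_cons, add_comm]

end IsHN

variable (σ) in
/-- The sequence is Cauchy for the generalised metric. -/
def IsDistCauchy : Prop :=
  ∀ ε > 0, ∃ N, ∀ m ≥ N, ∀ n ≥ N, ∀ X : C, ¬ IsZero X → distAt (σ m) (σ n) X ≤ ε

/-! ### Convergence of phases, masses and charges along a Cauchy sequence -/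

namespace IsDistCauchy

variable {X : C}

omit [IsTriangulated C] in
lemma tendsto_of_abs_sub_le (h : IsDistCauchy σ) {u : ℕ → ℝ} (hX : ¬ IsZero X)
    (hu : ∀ m n, |u m - u n| ≤ distAt (σ m) (σ n) X) : ∃ a, Tendsto u atTop (𝓝 a) := by
  refine cauchySeq_tendsto_of_complete (Metric.cauchySeq_iff.2 fun ε hε => ?_)
  obtain ⟨N, hN⟩ := h (ε / 2) (by linarith)
  exact ⟨N, fun m hm n hn => (Real.dist_eq _ _).trans_lt
    (lt_of_le_of_lt ((hu m n).trans (hN m hm n hn X hX)) (by linarith))⟩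

omit [IsTriangulated C] in
lemma tendsto_phiPlus (h : IsDistCauchy σ) (hX : ¬ IsZero X) :
    ∃ a, Tendsto (fun n => (σ n).phiPlus X) atTop (𝓝 a) :=
  h.tendsto_of_abs_sub_le hX fun _ _ => (le_max_right _ _).trans (le_max_left _ _)

omit [IsTriangulated C] in
lemma tendsto_phiMinus (h : IsDistCauchy σ) (hX : ¬ IsZero X) :
    ∃ a, Tendsto (fun n => (σ n).phiMinus X) atTop (𝓝 a) :=
  h.tendsto_of_abs_sub_le hX fun _ _ => (le_max_left _ _).trans (le_max_left _ _)

-- The logarithms of the masses are Cauchy, so the limit mass is an exponential and hence positive.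
-- This is what makes the limiting charge of a semistable object nonzero.
omit [IsTriangulated C] in
lemma tendsto_mass (h : IsDistCauchy σ) (hX : ¬ IsZero X) :
    ∃ a, 0 < a ∧ Tendsto (fun n => (σ n).mass X) atTop (𝓝 a) := by
  obtain ⟨a, ha⟩ := h.tendsto_of_abs_sub_le (u := fun n => Real.log ((σ n).mass X)) hX
    fun m n => by
      rw [← Real.log_div ((σ m).mass_pos X hX).ne' ((σ n).mass_pos X hX).ne']
      exact le_max_right _ _
  refine ⟨Real.exp a, Real.exp_pos a, ?_⟩
  have := (Real.continuous_exp.tendsto a).comp ha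
  refine this.congr fun n => ?_
  exact Real.exp_log ((σ n).mass_pos X hX)

variable {δ : ℝ} (h : IsDistCauchy σ) (hδ : 0 < δ)
  (hsupp : ∀ᶠ n in atTop, ∀ (φ : ℝ) (E : C), (σ n).P φ E → ¬ IsZero E →
    δ ≤ ‖(σ n).Z (K0.mk E)‖)
include h hδ hsupp

/-- An object whose limiting phases are distinct can be split so that the limiting phases of the
two parts are separated. -/
lemma exists_separation (hX : ¬ IsZero X) {k : ℕ} (hk : ∀ᶠ n in atTop, (σ n).mass X ≤ k * δ)
    {p q : ℝ} (hp : Tendsto (fun n => (σ n).phiMinus X) atTop (𝓝 p))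
    (hq : Tendsto (fun n => (σ n).phiPlus X) atTop (𝓝 q)) (hpq : p < q) :
    ∃ A B b a, IsExtension A X B ∧ ¬ IsZero A ∧ ¬ IsZero B ∧ b < a ∧
      (∀ᶠ n in atTop, Slice (σ n).P (Set.Ioi a) A) ∧
      ∀ᶠ n in atTop, Slice (σ n).P (Set.Iio b) B := by
  classical
  -- At a suitable index the phases of `X` spread over more than `q - p - 2ε = (4k + 2)ε`, which
  -- exceeds `k · 3ε`. With at most `k` factors there is a gap of width `3ε`; later phases move by
  -- at most `ε`, so at least `ε` of it survives.
  obtain ⟨ε, hε, hεpq⟩ : ∃ ε : ℝ, 0 < ε ∧ 4 * (k + 1) * ε = q - p :=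
    ⟨(q - p) / (4 * (k + 1)), div_pos (by linarith) (by positivity), by field_simp⟩
  obtain ⟨N, hN⟩ := h ε hε
  obtain ⟨n, hn, hs, hkn, hpn, hqn⟩ := ((eventually_ge_atTop N).and (hsupp.and (hk.and
    ((hp.eventually_lt_const (lt_add_of_pos_right p hε)).and
      (hq.eventually_const_lt (sub_lt_self q hε)))))).exists
  obtain ⟨l, hl⟩ := (σ n).exists_isHN X
  have hlen : l.length ≤ k := by
    have := (length_mul_le_mass hl hs).trans hkn
    exact_mod_cast le_of_mul_le_mul_right this hδ
  obtain ⟨x, hx, hx'⟩ := hl.exists_phiMinus hX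
  obtain ⟨y, hy, hy'⟩ := hl.exists_phiPlus hX
  obtain ⟨s, hs1, hs2, hs3⟩ := exists_gap (l.map Prod.fst).toFinset (k := k) (x := x.1) (y := y.1)
    (g := 3 * ε) ((List.toFinset_card_le _).trans (by simpa using hlen)) (by linarith)
    (by simpa using ⟨x.2, hx⟩) (by
      rw [hx', hy']
      nlinarith)
  obtain ⟨A, B, hext, hA, hB⟩ := hl.exists_truncation (isUpperSet_Ioi s)
  have hA0 : ¬ IsZero A := fun h0 => by
    have := List.filter_eq_nil_iff.1 (hA.eq_nil (σ n).isPreslicing h0) y hy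
    simp only [Set.mem_Ioi, decide_eq_true_eq, not_lt] at this
    linarith
  have hB0 : ¬ IsZero B := fun h0 => by
    have := List.filter_eq_nil_iff.1 (hB.eq_nil (σ n).isPreslicing h0) x hx
    simp only [Set.mem_Ioi, not_lt, decide_eq_true_eq, not_le] at this
    linarith
  have hA1 : s + 3 * ε < (σ n).phiMinus A := by
    refine (slice_Ioi_iff hA0).1 (hA.slice fun z hz => ?_)
    simp only [List.mem_filter, Set.mem_Ioi, decide_eq_true_eq] at hz
    exact hs3 z.1 (by simpa using ⟨z.2, hz.1⟩) hz.2
  have hB1 : (σ n).phiPlus B ≤ s := by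
    refine ((slice_iff hB0 Set.ordConnected_Iic).1 (hB.slice (J := Set.Iic s) fun z hz => ?_)).2
    simpa using (List.mem_filter.1 hz).2
  refine ⟨A, B, s + 3 / 2 * ε, s + 2 * ε, hext, hA0, hB0, by linarith, ?_, ?_⟩
  · filter_upwards [eventually_ge_atTop N] with m hm
    have h1 := ((le_max_left _ _).trans (le_max_left _ _)).trans (hN m hm n hn A hA0)
    rw [slice_Ioi_iff hA0]
    linarith [(abs_le.1 h1).1]
  · filter_upwards [eventually_ge_atTop N] with m hm
    have h1 := ((le_max_right _ _).trans (le_max_left _ _)).trans (hN m hm n hn B hB0)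
    rw [slice_Iio_iff hB0]
    linarith [(abs_le.1 h1).2]

/-- The number `k` bounds mass in units of `δ`. Each of the two pieces produced by
`exists_separation` has mass at least `δ`, so the other one satisfies the bound with `k - 1`. -/
lemma exists_isHN_of_mass_le (k : ℕ) (X : C) (hk : ∀ᶠ n in atTop, (σ n).mass X ≤ k * δ) :
    ∃ l, IsHN (limitingSemistable σ) l X := by
  have hmass : ∀ Y : C, ¬ IsZero Y → ∀ᶠ n in atTop, δ ≤ (σ n).mass Y := fun Y hY =>
    hsupp.mono fun n hn => le_mass hδ.le hn hY
  induction k generalizing X with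
  | zero =>
    by_cases hX : IsZero X
    · exact ⟨[], .nil X hX⟩
    · obtain ⟨n, h1, h2⟩ := (hk.and (hmass X hX)).exists
      rw [Nat.cast_zero, zero_mul] at h1
      linarith
  | succ k ih =>
    by_cases hX : IsZero X
    · exact ⟨[], .nil X hX⟩
    obtain ⟨p, hp⟩ := h.tendsto_phiMinus hX
    obtain ⟨q, hq⟩ := h.tendsto_phiPlus hX
    have hpq : p ≤ q := le_of_tendsto_of_tendsto' hp hq fun n => phiMinus_le_phiPlus hX
    rcases hpq.eq_or_lt with rfl | hpq
    · exact ⟨_, .single (φ := p) (.of X ⟨hX, hq, hp⟩) hX⟩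
    obtain ⟨A, B, b, a, hext, hA0, hB0, hba, hA, hB⟩ :=
      h.exists_separation hδ hsupp hX hk hp hq hpq
    have hadd : ∀ᶠ n in atTop, (σ n).mass X = (σ n).mass A + (σ n).mass B := by
      filter_upwards [hA, hB] with n h1 h2
      exact mass_eq_add hext Set.ordConnected_Ioi Set.ordConnected_Iio h1 h2
        (fun φ hφ φ' hφ' => lt_trans hφ' (hba.trans hφ))
    obtain ⟨l, hl⟩ := ih A (by
      filter_upwards [hk, hadd, hmass B hB0] with n h1 h2 h3
      push_cast at h1
      linarith)
    obtain ⟨l', hl'⟩ := ih B (by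
      filter_upwards [hk, hadd, hmass A hA0] with n h1 h2 h3
      push_cast at h1
      linarith)
    exact ⟨_, hl.concat hl' hext fun z hz z' hz' => ((hl'.ge_of_eventually_slice hB z hz).trans_lt
      hba).trans_le (hl.le_of_eventually_slice hA z' hz')⟩

lemma exists_isHN_limitingSemistable (X : C) : ∃ l, IsHN (limitingSemistable σ) l X := by
  by_cases hX : IsZero X
  · exact ⟨[], .nil X hX⟩
  obtain ⟨a, _, ha⟩ := h.tendsto_mass hX
  obtain ⟨k, hk⟩ := exists_nat_gt (a / δ)
  rw [div_lt_iff₀ hδ] at hk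
  exact h.exists_isHN_of_mass_le hδ hsupp k X
    ((ha.eventually_lt_const hk).mono fun n hn => hn.le)

-- For large `n` all phases of `X` are within a small `ε` of `θ`, so the charge differs from mass
-- times `exp (iπθ)` by at most mass times `πε`, and the masses converge.
omit hδ hsupp in
lemma tendsto_charge_of_limitingSemistable {θ : ℝ} (hX : limitingSemistable σ θ X) :
    ∃ a : ℝ, (¬ IsZero X → 0 < a) ∧ Tendsto (fun n => (σ n).mass X) atTop (𝓝 a) ∧
      Tendsto (fun n => (σ n).Z (K0.mk X)) atTop
        (𝓝 (a * Complex.exp (Complex.I * Real.pi * θ))) := by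
  by_cases h0 : IsZero X
  · refine ⟨0, fun h => absurd h0 h, ?_, ?_⟩
    · simp [mass_of_isZero _ h0]
    · simp [K0.mk_of_isZero h0]
  obtain ⟨a, ha0, ha⟩ := h.tendsto_mass h0
  refine ⟨a, fun _ => ha0, ha, ?_⟩
  have h1 : Tendsto (fun n => ((σ n).mass X : ℂ) * Complex.exp (Complex.I * Real.pi * θ)) atTop
      (𝓝 (a * Complex.exp (Complex.I * Real.pi * θ))) :=
    ((Complex.continuous_ofReal.tendsto a).comp ha).mul_const _
  refine tendsto_of_tendsto_of_dist h1 (Metric.tendsto_atTop'.2 fun ε hε => ?_)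
  have hpos : 0 < (a + 1) * Real.pi := by positivity
  obtain ⟨N, hN⟩ := eventually_atTop.1 ((limitingSemistable_iff.1 hX (ε / (2 * ((a + 1) * Real.pi)))
    (by positivity)).and (ha.eventually_lt_const (lt_add_one a)))
  refine ⟨N, fun n hn => ?_⟩
  obtain ⟨h2, h3⟩ := hN n hn.le
  rw [Real.dist_eq, sub_zero, abs_of_nonneg dist_nonneg, dist_comm, dist_eq_norm]
  refine (norm_charge_sub_le h2).trans_lt ?_
  calc (σ n).mass X * (Real.pi * (ε / (2 * ((a + 1) * Real.pi))))
      ≤ (a + 1) * (Real.pi * (ε / (2 * ((a + 1) * Real.pi)))) := by gcongr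
    _ = ε / 2 := by field_simp
    _ < ε := by linarith

lemma exists_tendsto_charge (x : K0 C) :
    ∃ z, Tendsto (fun n => (σ n).Z x) atTop (𝓝 z) := by
  refine K0.induction (p := fun x => ∃ z, Tendsto (fun n => (σ n).Z x) atTop (𝓝 z)) x
    ⟨0, by simp⟩ (fun X => ?_) (fun x ⟨z, hz⟩ => ⟨-z, ?_⟩)
    (fun x y ⟨z, hz⟩ ⟨z', hz'⟩ => ⟨z + z', ?_⟩)
  · obtain ⟨l, hl⟩ := h.exists_isHN_limitingSemistable hδ hsupp X
    induction hl with
    | nil X hX => exact ⟨0, by simp [K0.mk_of_isZero hX]⟩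
    | cons φ l hext _ hB _ _ ih =>
      obtain ⟨z, hz⟩ := ih
      obtain ⟨a, _, _, ha⟩ := h.tendsto_charge_of_limitingSemistable hB
      refine ⟨_, (hz.add ha).congr fun n => ?_⟩
      rw [hext.k0_mk, map_add]
  · simpa using hz.neg
  · simpa using hz.add hz'

/-- A Cauchy sequence of stability conditions whose semistable objects have masses bounded below
converges. -/
theorem exists_limit : ∃ τ : StabilityCondition C, τ.P = limitingSemistable σ ∧
    (∀ x, Tendsto (fun n => (σ n).Z x) atTop (𝓝 (τ.Z x))) ∧
    ∀ X, ¬ IsZero X → Tendsto (fun n => (σ n).phiPlus X) atTop (𝓝 (τ.phiPlus X)) ∧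
      Tendsto (fun n => (σ n).phiMinus X) atTop (𝓝 (τ.phiMinus X)) ∧
      Tendsto (fun n => (σ n).mass X) atTop (𝓝 (τ.mass X)) := by
  have hP := isPreslicing_limitingSemistable σ
  choose Z hZ using h.exists_tendsto_charge hδ hsupp
  let τ : StabilityCondition C :=
    { Z :=
        { toFun := Z
          map_zero' := tendsto_nhds_unique (hZ 0) (by simp)
          map_add' := fun x y => tendsto_nhds_unique (hZ (x + y))
            (((hZ x).add (hZ y)).congr fun n => (map_add _ _ _).symm) }
      P := limitingSemistable σ
      P_iso := hP.iso
      P_zero := hP.zero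
      P_biprod := fun φ X Y hX hY => ExtClosure.ofExtension (.biprod X Y) hX hY
      charge := fun φ X hX hX0 => by
        obtain ⟨a, ha, _, ha'⟩ := h.tendsto_charge_of_limitingSemistable hX
        exact ⟨a, ha hX0, tendsto_nhds_unique (hZ _) ha'⟩
      P_shift := hP.shift
      hom_eq_zero := hP.hom_eq_zero
      exists_hn := fun X hX => by
        obtain ⟨l, hl⟩ := h.exists_isHN_limitingSemistable hδ hsupp X
        exact hl.nonempty_hnFiltration hX }
  refine ⟨τ, rfl, hZ, fun X hX => ?_⟩
  obtain ⟨l, hl⟩ := τ.exists_isHN X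
  refine ⟨?_, ?_, ?_⟩
  · obtain ⟨q, hq⟩ := h.tendsto_phiPlus hX
    obtain ⟨z, hz, hz'⟩ := hl.exists_phiPlus hX
    -- Both inequalities are tested on strict bounds `b`: those valid along the sequence pass weakly
    -- to the factors of the limit filtration, and those valid for the limit factors hold eventually
    -- along the sequence.
    have h1 : τ.phiPlus X ≤ q := le_of_forall_gt_imp_ge_of_dense fun b hb => hz' ▸
      IsHN.ge_of_eventually_slice (σ := σ) hl
        ((hq.eventually_lt_const hb).mono fun n hn => (slice_Iio_iff hX).2 hn) z hz
    have h2 : q ≤ τ.phiPlus X := le_of_forall_gt_imp_ge_of_dense fun b hb =>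
      le_of_tendsto hq ((IsHN.eventually_slice_Iio (σ := σ) hl fun p hp =>
        (hl.phase_mem_Icc hp).2.trans_lt hb).mono fun n hn => ((slice_Iio_iff hX).1 hn).le)
    rwa [le_antisymm h1 h2]
  · obtain ⟨q, hq⟩ := h.tendsto_phiMinus hX
    obtain ⟨z, hz, hz'⟩ := hl.exists_phiMinus hX
    have h1 : q ≤ τ.phiMinus X := le_of_forall_lt_imp_le_of_dense fun b hb => hz' ▸
      IsHN.le_of_eventually_slice (σ := σ) hl
        ((hq.eventually_const_lt hb).mono fun n hn => (slice_Ioi_iff hX).2 hn) z hz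
    have h2 : τ.phiMinus X ≤ q := le_of_forall_lt_imp_le_of_dense fun b hb =>
      ge_of_tendsto hq ((IsHN.eventually_slice_Ioi (σ := σ) hl fun p hp =>
        lt_of_lt_of_le hb (hl.phase_mem_Icc hp).1).mono fun n hn => ((slice_Ioi_iff hX).1 hn).le)
    rwa [le_antisymm h2 h1]
  · have h1 : ∀ (θ : ℝ) (E : C), limitingSemistable σ θ E →
        Tendsto (fun n => (σ n).mass E) atTop (𝓝 ‖τ.Z (K0.mk E)‖) := by
      intro θ E hE
      obtain ⟨a, _, ha, ha'⟩ := h.tendsto_charge_of_limitingSemistable hE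
      have h2 := tendsto_nhds_unique (hZ (K0.mk E)) ha'
      have h3 : 0 ≤ a := ge_of_tendsto' ha fun n => mass_nonneg E
      have h4 : ‖τ.Z (K0.mk E)‖ = a := by
        change ‖Z (K0.mk E)‖ = a
        rw [h2, norm_mul, Complex.norm_real, Real.norm_of_nonneg h3,
          show Complex.I * Real.pi * θ = ((Real.pi * θ : ℝ) : ℂ) * Complex.I by push_cast; ring,
          Complex.norm_exp_ofReal_mul_I, mul_one]
      rwa [h4]
    rw [hl.mass_eq]
    have h5 : Tendsto (fun n => (l.map fun p => (σ n).mass p.2).sum) atTop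
        (𝓝 (l.map fun p => ‖τ.Z (K0.mk p.2)‖).sum) :=
      tendsto_list_sum l fun p hp => h1 p.1 p.2 (hl.mem p hp).1
    exact h5.congr' ((IsHN.eventually_mass_eq (σ := σ) hl).mono fun n hn => hn.symm)

end IsDistCauchy

end Stability

namespace Stability

variable {C : Type u} [Category.{v} C] [Preadditive C] [HasZeroObject C] [HasShift C ℤ]
  [∀ n : ℤ, (shiftFunctor C n).Additive] [Pretriangulated C]

/-! ### Exactness of distinguished triangles -/

section Exactness

variable {A X B W : C} {f : A ⟶ X} {g : X ⟶ B} {d : B ⟶ A⟦(1 : ℤ)⟧}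

lemma exists_lift_of_distTriang (hT : Triangle.mk f g d ∈ distTriang C) (w : W ⟶ X)
    (hw : w ≫ g = 0) : ∃ u, u ≫ f = w := by
  obtain ⟨u, hu⟩ := Triangle.coyoneda_exact₂ _ hT w hw
  exact ⟨u, hu.symm⟩

lemma exists_desc_of_distTriang (hT : Triangle.mk f g d ∈ distTriang C) (w : X ⟶ W)
    (hw : f ≫ w = 0) : ∃ u, g ≫ u = w := by
  obtain ⟨u, hu⟩ := Triangle.yoneda_exact₂ _ hT w hw
  exact ⟨u, hu.symm⟩

lemma eq_zero_of_comp_mor₁ (hT : Triangle.mk f g d ∈ distTriang C)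
    (hW : ∀ v : W ⟶ B⟦(-1 : ℤ)⟧, v = 0) (u : W ⟶ A) (hu : u ≫ f = 0) : u = 0 := by
  obtain ⟨v, hv⟩ := Triangle.coyoneda_exact₂ _ (inv_rot_of_distTriang _ hT) u hu
  rw [hW v] at hv
  exact hv.trans zero_comp

lemma eq_zero_of_mor₂_comp (hT : Triangle.mk f g d ∈ distTriang C)
    (hW : ∀ v : A⟦(1 : ℤ)⟧ ⟶ W, v = 0) (u : B ⟶ W) (hu : g ≫ u = 0) : u = 0 := by
  obtain ⟨v, hv⟩ := Triangle.yoneda_exact₃ _ hT u hu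
  rw [hW v] at hv
  exact hv.trans comp_zero

lemma distTriang_comp_zero (hT : Triangle.mk f g d ∈ distTriang C) : f ≫ g = 0 :=
  comp_distTriang_mor_zero₁₂ _ hT

lemma distTriang_of_iso₁ (hT : Triangle.mk f g d ∈ distTriang C) {A' : C} (e : A' ≅ A)
    {f' : A' ⟶ X} (hf' : e.hom ≫ f = f') : ∃ d', Triangle.mk f' g d' ∈ distTriang C := by
  refine ⟨d ≫ e.inv⟦1⟧', isomorphic_distinguished _ hT _
    (Triangle.isoMk _ _ e (Iso.refl X) (Iso.refl B) ?_ ?_ ?_)⟩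
  · change f' ≫ 𝟙 X = e.hom ≫ f
    rw [Category.comp_id, hf']
  · change g ≫ 𝟙 B = 𝟙 X ≫ g
    rw [Category.comp_id, Category.id_comp]
  · change (d ≫ e.inv⟦1⟧') ≫ e.hom⟦1⟧' = 𝟙 B ≫ d
    rw [Category.assoc, ← Functor.map_comp, e.inv_hom_id, CategoryTheory.Functor.map_id,
      Category.comp_id, Category.id_comp]

lemma distTriang_of_iso₂ (hT : Triangle.mk f g d ∈ distTriang C) {X' : C} (e : X' ≅ X)
    {f' : A ⟶ X'} {g' : X' ⟶ B} (hf' : f' ≫ e.hom = f) (hg' : e.hom ≫ g = g') :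
    Triangle.mk f' g' d ∈ distTriang C := by
  refine isomorphic_distinguished _ hT _
    (Triangle.isoMk _ _ (Iso.refl A) e (Iso.refl B) ?_ ?_ ?_)
  · change f' ≫ e.hom = 𝟙 A ≫ f
    rw [Category.id_comp, hf']
  · change g' ≫ 𝟙 B = e.hom ≫ g
    rw [Category.comp_id, hg']
  · change d ≫ (𝟙 A)⟦1⟧' = 𝟙 B ≫ d
    rw [CategoryTheory.Functor.map_id, Category.comp_id, Category.id_comp]

lemma distTriang_of_iso₃ (hT : Triangle.mk f g d ∈ distTriang C) {B' : C} (e : B ≅ B')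
    {g' : X ⟶ B'} (hg' : g ≫ e.hom = g') : ∃ d', Triangle.mk f g' d' ∈ distTriang C := by
  refine ⟨e.inv ≫ d, isomorphic_distinguished _ hT _
    (Triangle.isoMk _ _ (Iso.refl A) (Iso.refl X) e.symm ?_ ?_ ?_)⟩
  · change f ≫ 𝟙 X = 𝟙 A ≫ f
    rw [Category.comp_id, Category.id_comp]
  · change g' ≫ e.inv = 𝟙 X ≫ g
    rw [← hg', Category.assoc, e.hom_inv_id, Category.comp_id, Category.id_comp]
  · change (e.inv ≫ d) ≫ (𝟙 A)⟦1⟧' = e.inv ≫ d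
    rw [CategoryTheory.Functor.map_id, Category.comp_id]

end Exactness

/-! ### The categories `P(a, b)` with `b ≤ a + 1` -/

section PhaseInterval

variable {σ : StabilityCondition C} {a b : ℝ}

/-- A sequence in `P(a, b)` which underlies an exact triangle. -/
def IsConflation {S X Q : (σ.phaseInterval (Set.Ioo a b)).FullSubcategory} (i : S ⟶ X)
    (p : X ⟶ Q) : Prop :=
  ∃ d, Triangle.mk i.hom p.hom d ∈ distTriang C

lemma hom_eq_zero_of_le {I J : Set ℝ} {X Y : C} (hX : Slice σ.P I X) (hY : Slice σ.P J Y)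
    (c : ℝ) (hI : ∀ φ ∈ I, c < φ) (hJ : ∀ φ ∈ J, φ ≤ c) (f : X ⟶ Y) : f = 0 :=
  hX.hom_eq_zero σ.isPreslicing hY (fun φ hφ φ' hφ' => (hJ φ' hφ').trans_lt (hI φ hφ)) f

lemma hom_eq_zero_of_ge {I J : Set ℝ} {X Y : C} (hX : Slice σ.P I X) (hY : Slice σ.P J Y)
    (c : ℝ) (hI : ∀ φ ∈ I, c ≤ φ) (hJ : ∀ φ ∈ J, φ < c) (f : X ⟶ Y) : f = 0 :=
  hX.hom_eq_zero σ.isPreslicing hY (fun φ hφ φ' hφ' => (hJ φ' hφ').trans_le (hI φ hφ)) f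

namespace IsConflation

variable {S X Q W : (σ.phaseInterval (Set.Ioo a b)).FullSubcategory} {i : S ⟶ X} {p : X ⟶ Q}
  (h : IsConflation i p)

include h

lemma comp_eq_zero : i ≫ p = 0 := by
  obtain ⟨d, hT⟩ := h
  exact ObjectProperty.hom_ext _ (distTriang_comp_zero hT)

lemma exists_lift (w : W ⟶ X) (hw : w ≫ p = 0) : ∃ u, u ≫ i = w := by
  obtain ⟨d, hT⟩ := h
  obtain ⟨u, hu⟩ := exists_lift_of_distTriang hT w.hom (congrArg (·.hom) hw)
  exact ⟨ObjectProperty.homMk u, ObjectProperty.hom_ext _ hu⟩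

lemma exists_desc (w : X ⟶ W) (hw : i ≫ w = 0) : ∃ u, p ≫ u = w := by
  obtain ⟨d, hT⟩ := h
  obtain ⟨u, hu⟩ := exists_desc_of_distTriang hT w.hom (congrArg (·.hom) hw)
  exact ⟨ObjectProperty.homMk u, ObjectProperty.hom_ext _ hu⟩

variable (hab : b ≤ a + 1)
include hab

/-- The condition `b ≤ a + 1` puts the phases of `Q⟦-1⟧` at or below `a`, so no object of `P(a, b)`
maps to it nontrivially. -/
lemma mono : Mono i := by
  obtain ⟨d, hT⟩ := h
  refine (Preadditive.mono_iff_cancel_zero _).2 fun W u hu => ObjectProperty.hom_ext _ ?_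
  refine eq_zero_of_comp_mor₁ hT (fun v => ?_) u.hom (congrArg (·.hom) hu)
  exact hom_eq_zero_of_le W.property
    (Slice.unshift σ.isPreslicing (J' := Set.Iic a) (fun φ hφ => by
      have := hφ.2
      simp only [Set.mem_Iic]
      linarith) Q.property) a (fun φ hφ => hφ.1) (fun φ hφ => hφ) v

lemma epi : Epi p := by
  obtain ⟨d, hT⟩ := h
  refine (Preadditive.epi_iff_cancel_zero _).2 fun W u hu => ObjectProperty.hom_ext _ ?_
  refine eq_zero_of_mor₂_comp hT (fun v => ?_) u.hom (congrArg (·.hom) hu)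
  exact hom_eq_zero_of_ge (Slice.shift σ.isPreslicing (J' := Set.Ici b) (fun φ hφ => by
      have := hφ.1
      simp only [Set.mem_Ici]
      linarith) S.property) W.property b (fun φ hφ => hφ) (fun φ hφ => hφ.2) v

lemma normalMono : Nonempty (NormalMono i) := by
  have := h.mono hab
  exact ⟨⟨Q, p, h.comp_eq_zero, KernelFork.IsLimit.ofι' _ _ fun k hk =>
    ⟨_, (h.exists_lift k hk).choose_spec⟩⟩⟩

lemma normalEpi : Nonempty (NormalEpi p) := by
  have := h.epi hab
  exact ⟨⟨S, i, h.comp_eq_zero, CokernelCofork.IsColimit.ofπ' _ _ fun k hk =>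
    ⟨_, (h.exists_desc k hk).choose_spec⟩⟩⟩

end IsConflation

variable [IsTriangulated C]

open scoped Classical in
lemma exists_triangle_of_isUpperSet {U J : Set ℝ} (hU : IsUpperSet U) (hJ : J.OrdConnected)
    {X : C} (hX : Slice σ.P J X) :
    ∃ (A B : C) (f : A ⟶ X) (g : X ⟶ B) (d : B ⟶ A⟦(1 : ℤ)⟧),
      Triangle.mk f g d ∈ distTriang C ∧ Slice σ.P (J ∩ U) A ∧ Slice σ.P (J \ U) B := by
  obtain ⟨l, hl⟩ := σ.exists_isHN X
  obtain ⟨A, B, ⟨f, g, d, hT⟩, hA, hB⟩ := hl.exists_truncation hU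
  have hm := hl.mem_of_slice σ.isPreslicing hJ hX
  refine ⟨A, B, f, g, d, hT, hA.slice fun p hp => ?_, hB.slice fun p hp => ?_⟩
  · obtain ⟨h1, h2⟩ := List.mem_filter.1 hp
    exact ⟨hm p h1, by simpa using h2⟩
  · obtain ⟨h1, h2⟩ := List.mem_filter.1 hp
    exact ⟨hm p h1, by simpa using h2⟩

lemma slice_Ioo_of_Ioi_of_Iio {X : C} (h1 : Slice σ.P (Set.Ioi a) X)
    (h2 : Slice σ.P (Set.Iio b) X) : Slice σ.P (Set.Ioo a b) X := by
  obtain ⟨l, hl⟩ := σ.exists_isHN X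
  exact hl.slice fun p hp => ⟨hl.mem_of_slice σ.isPreslicing Set.ordConnected_Ioi h1 p hp,
    hl.mem_of_slice σ.isPreslicing Set.ordConnected_Iio h2 p hp⟩

/-! ### Kernels, cokernels and strict morphisms in `P(a, b)` -/

variable (hab : b ≤ a + 1)
include hab

/-- The fibre of `f` has phases in `(a - 1, b)`. Its part `A` of phase `> a` is the kernel, since
nothing in `P(a, b)` maps to the remaining part `B`. The cone `Q` of `A ⟶ X` stays in `P(a, b)`:
from `X` and `A⟦1⟧` its phases are `> a`, and the octahedron exhibits it as an extension of `Y` by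
`B`, so they are `< b`. -/
lemma exists_kernel_conflation {X Y : (σ.phaseInterval (Set.Ioo a b)).FullSubcategory}
    (f : X ⟶ Y) :
    ∃ (K Q : (σ.phaseInterval (Set.Ioo a b)).FullSubcategory) (k : K ⟶ X) (p : X ⟶ Q),
      IsConflation k p ∧ k ≫ f = 0 ∧
        ∀ (W : (σ.phaseInterval (Set.Ioo a b)).FullSubcategory) (w : W ⟶ X), w ≫ f = 0 →
          ∃ u, u ≫ k = w := by
  obtain ⟨F, i, d, hT⟩ := distinguished_cocone_triangle₁ f.hom
  have hF : Slice σ.P (Set.Ioo (a - 1) b) F :=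
    .ofExtension (IsExtension.invRotate ⟨_, _, _, hT⟩)
      (Slice.unshift σ.isPreslicing (J := Set.Ioo a b) (fun φ hφ => by
        simp only [Set.mem_Ioo] at hφ ⊢
        constructor <;> linarith) Y.property)
      (Slice.mono (J := Set.Ioo a b) (Set.Ioo_subset_Ioo_left (by linarith)) X.property)
  obtain ⟨A, B, j, g, e, hT', hA, hB⟩ := exists_triangle_of_isUpperSet (isUpperSet_Ioi a)
    Set.ordConnected_Ioo hF
  obtain ⟨Q, p, d', hQ⟩ := distinguished_cocone_triangle (j ≫ i)
  have o : IsExtension B Q Y.obj := ⟨_, _, _, (Triangulated.someOctahedron rfl hT' hT hQ).mem⟩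
  have hA' : Slice σ.P (Set.Ioo a b) A := hA.mono (J' := Set.Ioo a b) fun φ hφ => ⟨hφ.2, hφ.1.2⟩
  have hQ' : Slice σ.P (Set.Ioo a b) Q := by
    refine slice_Ioo_of_Ioi_of_Iio ?_ ?_
    · refine .ofExtension (IsExtension.rotate (show IsExtension A X.obj Q from ⟨_, _, _, hQ⟩))
        (Slice.mono (J := Set.Ioo a b) (fun φ hφ => hφ.1) X.property)
        (hA'.shift σ.isPreslicing fun φ hφ => ?_)
      have := hφ.1
      simp only [Set.mem_Ioi]
      linarith
    · exact .ofExtension o (hB.mono fun φ hφ => hφ.1.2)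
        (Slice.mono (J := Set.Ioo a b) (fun φ hφ => hφ.2) Y.property)
  refine ⟨⟨A, hA'⟩, ⟨Q, hQ'⟩, ObjectProperty.homMk (j ≫ i), ObjectProperty.homMk p, ⟨d', hQ⟩,
    ObjectProperty.hom_ext _ ?_, fun W w hw => ?_⟩
  · change (j ≫ i) ≫ f.hom = 0
    rw [Category.assoc, distTriang_comp_zero hT, comp_zero]
  · obtain ⟨u, hu⟩ := exists_lift_of_distTriang hT w.hom (congrArg (·.hom) hw)
    obtain ⟨u', hu'⟩ := exists_lift_of_distTriang hT' u
      (hom_eq_zero_of_le W.property hB a (fun φ hφ => hφ.1) (fun φ hφ => not_lt.1 hφ.2) _)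
    refine ⟨ObjectProperty.homMk u', ObjectProperty.hom_ext _ ?_⟩
    change u' ≫ j ≫ i = w.hom
    rw [← Category.assoc, hu', hu]

/-- Dual construction: the cokernel is the part of phase `< b` of the cone of `f`. -/
lemma exists_cokernel_conflation {X Y : (σ.phaseInterval (Set.Ioo a b)).FullSubcategory}
    (f : X ⟶ Y) :
    ∃ (K Q : (σ.phaseInterval (Set.Ioo a b)).FullSubcategory) (k : K ⟶ Y) (p : Y ⟶ Q),
      IsConflation k p ∧ f ≫ p = 0 ∧
        ∀ (W : (σ.phaseInterval (Set.Ioo a b)).FullSubcategory) (w : Y ⟶ W), f ≫ w = 0 →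
          ∃ u, p ≫ u = w := by
  obtain ⟨G, g, d, hT⟩ := distinguished_cocone_triangle f.hom
  have hG : Slice σ.P (Set.Ioo a (b + 1)) G :=
    .ofExtension (IsExtension.rotate ⟨_, _, _, hT⟩)
      (Slice.mono (J := Set.Ioo a b) (Set.Ioo_subset_Ioo_right (by linarith)) Y.property)
      (Slice.shift σ.isPreslicing (J := Set.Ioo a b) (fun φ hφ => by
        simp only [Set.mem_Ioo] at hφ ⊢
        constructor <;> linarith) X.property)
  obtain ⟨A, B, j, r, e, hT', hA, hB⟩ := exists_triangle_of_isUpperSet (isUpperSet_Ici b)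
    Set.ordConnected_Ioo hG
  obtain ⟨K, k, d', hK⟩ := distinguished_cocone_triangle₁ (g ≫ r)
  have o : IsExtension X.obj K A := ⟨_, _, _, (Triangulated.someOctahedron' rfl hT hT' hK).mem⟩
  have hB' : Slice σ.P (Set.Ioo a b) B := hB.mono (J' := Set.Ioo a b) fun φ hφ => ⟨hφ.1.1, not_le.1 hφ.2⟩
  have hK' : Slice σ.P (Set.Ioo a b) K := by
    refine slice_Ioo_of_Ioi_of_Iio ?_ ?_
    · exact .ofExtension o (Slice.mono (J := Set.Ioo a b) (fun φ hφ => hφ.1) X.property)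
        (hA.mono fun φ hφ => hφ.1.1)
    · refine .ofExtension (IsExtension.invRotate (show IsExtension K Y.obj B from ⟨_, _, _, hK⟩))
        (hB'.unshift σ.isPreslicing fun φ hφ => ?_)
        (Slice.mono (J := Set.Ioo a b) (fun φ hφ => hφ.2) Y.property)
      have := hφ.2
      simp only [Set.mem_Iio]
      linarith
  refine ⟨⟨K, hK'⟩, ⟨B, hB'⟩, ObjectProperty.homMk k, ObjectProperty.homMk (g ≫ r), ⟨d', hK⟩,
    ObjectProperty.hom_ext _ ?_, fun W w hw => ?_⟩
  · change f.hom ≫ g ≫ r = 0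
    rw [← Category.assoc, distTriang_comp_zero hT, zero_comp]
  · obtain ⟨u, hu⟩ := exists_desc_of_distTriang hT w.hom (congrArg (·.hom) hw)
    obtain ⟨u', hu'⟩ := exists_desc_of_distTriang hT' u
      (hom_eq_zero_of_ge hA W.property b (fun φ hφ => hφ.2) (fun φ hφ => hφ.2) _)
    refine ⟨ObjectProperty.homMk u', ObjectProperty.hom_ext _ ?_⟩
    change (g ≫ r) ≫ u' = w.hom
    rw [Category.assoc, hu', hu]

/-- A strict mono is the kernel of some `g`, hence isomorphic to the kernel of `g` already realised
inside an exact triangle. So strict subobjects are exactly the first terms of triangles in `P(a,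
b)`. -/
lemma exists_conflation_of_normalMono
    {S X : (σ.phaseInterval (Set.Ioo a b)).FullSubcategory} {i : S ⟶ X}
    (hi : Nonempty (NormalMono i)) : ∃ Q, ∃ p : X ⟶ Q, IsConflation i p := by
  obtain ⟨⟨Z, g, w, hlim⟩⟩ := hi
  obtain ⟨K, Q, k, p, hc, hk, hlift⟩ := exists_kernel_conflation hab g
  obtain ⟨u, hu⟩ := hlift S i w
  have hv : hlim.lift (KernelFork.ofι k hk) ≫ i = k := hlim.fac _ WalkingParallelPair.zero
  have := hc.mono hab
  have hi : Mono i := mono_of_isLimit_fork hlim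
  let e : S ≅ K := ⟨u, hlim.lift (KernelFork.ofι k hk),
    by rw [← cancel_mono i, Category.assoc, hv, hu, Category.id_comp],
    by rw [← cancel_mono k, Category.assoc, hu, hv, Category.id_comp]⟩
  obtain ⟨d, hd⟩ := hc
  exact ⟨Q, p, distTriang_of_iso₁ hd ((ObjectProperty.ι _).mapIso e) (congrArg (·.hom) hu)⟩

lemma exists_conflation_of_normalEpi
    {X Q : (σ.phaseInterval (Set.Ioo a b)).FullSubcategory} {p : X ⟶ Q}
    (hp : Nonempty (NormalEpi p)) : ∃ S, ∃ i : S ⟶ X, IsConflation i p := by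
  obtain ⟨⟨Z, g, w, hcolim⟩⟩ := hp
  obtain ⟨K, Q', k, p', hc, hk, hdesc⟩ := exists_cokernel_conflation hab g
  obtain ⟨u, hu⟩ := hdesc Q p w
  have hv : p ≫ hcolim.desc (CokernelCofork.ofπ p' hk) = p' :=
    hcolim.fac _ WalkingParallelPair.one
  have := hc.epi hab
  have hp : Epi p := epi_of_isColimit_cofork hcolim
  let e : Q' ≅ Q := ⟨u, hcolim.desc (CokernelCofork.ofπ p' hk),
    by rw [← cancel_epi p', ← Category.assoc, hu, hv, Category.comp_id],
    by rw [← cancel_epi p, ← Category.assoc, hv, hu, Category.comp_id]⟩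
  obtain ⟨d, hd⟩ := hc
  exact ⟨K, k, distTriang_of_iso₃ hd ((ObjectProperty.ι _).mapIso e) (congrArg (·.hom) hu)⟩

lemma normalEpi_of_isPullback {W X Y Z : (σ.phaseInterval (Set.Ioo a b)).FullSubcategory}
    {fst : W ⟶ X} {snd : W ⟶ Y} {f : X ⟶ Z} {g : Y ⟶ Z} (h : IsPullback fst snd f g)
    (hg : Nonempty (NormalEpi g)) : Nonempty (NormalEpi fst) := by
  obtain ⟨K, k, hc⟩ := exists_conflation_of_normalEpi hab hg
  have hkmono := hc.mono hab
  obtain ⟨d, hT⟩ := id hc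
  -- `E` is the extension of `X` by `K` pulled back along `f`. It lies in `P(a, b)`, and the rest of
  -- the proof identifies it with the categorical pullback `W`.
  obtain ⟨E, i, p, hE⟩ := distinguished_cocone_triangle₂ (f.hom ≫ d)
  obtain ⟨t, ht1, ht2⟩ := complete_distinguished_triangle_morphism₂ _ _ hE hT (𝟙 K.obj) f.hom
    (by
      change (f.hom ≫ d) ≫ (𝟙 K.obj)⟦1⟧' = f.hom ≫ d
      rw [CategoryTheory.Functor.map_id, Category.comp_id])
  change i ≫ t = 𝟙 K.obj ≫ k.hom at ht1
  change p ≫ f.hom = t ≫ g.hom at ht2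
  rw [Category.id_comp] at ht1
  let E' : (σ.phaseInterval (Set.Ioo a b)).FullSubcategory :=
    ⟨E, Slice.ofExtension ⟨_, _, _, hE⟩ K.property X.property⟩
  let i' : K ⟶ E' := ObjectProperty.homMk i
  let p' : E' ⟶ X := ObjectProperty.homMk p
  let t' : E' ⟶ Y := ObjectProperty.homMk t
  have hE' : IsConflation i' p' := ⟨_, hE⟩
  have hit : i' ≫ t' = k := ObjectProperty.hom_ext _ ht1
  have hpt : p' ≫ f = t' ≫ g := ObjectProperty.hom_ext _ ht2
  have hgd : g.hom ≫ d = 0 := comp_distTriang_mor_zero₂₃ _ hT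
  obtain ⟨s₀, hs₀⟩ : ∃ s₀ : W ⟶ E', s₀ ≫ p' = fst := by
    obtain ⟨s, hs⟩ := Triangle.coyoneda_exact₃ _ hE fst.hom (by
      change fst.hom ≫ f.hom ≫ d = 0
      have hw : fst.hom ≫ f.hom = snd.hom ≫ g.hom := congrArg (·.hom) h.w
      rw [← Category.assoc, hw, Category.assoc, hgd, comp_zero])
    exact ⟨ObjectProperty.homMk s, ObjectProperty.hom_ext _ hs.symm⟩
  -- A lift of `fst` to `E` need not be compatible with `snd`; the discrepancy lands in the kernel
  -- `K` and can be subtracted.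
  obtain ⟨r, hr⟩ := hc.exists_lift (s₀ ≫ t' - snd) (by
    rw [Preadditive.sub_comp, Category.assoc, ← hpt, ← Category.assoc, hs₀, h.w, sub_self])
  have hs1 : (s₀ - r ≫ i') ≫ p' = fst := by
    rw [Preadditive.sub_comp, Category.assoc, hE'.comp_eq_zero, comp_zero, sub_zero, hs₀]
  have hs2 : (s₀ - r ≫ i') ≫ t' = snd := by
    rw [Preadditive.sub_comp, Category.assoc, hit, hr, sub_sub_cancel]
  let e : W ≅ E' := by
    refine ⟨s₀ - r ≫ i', h.lift p' t' hpt, ?_, ?_⟩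
    · apply h.hom_ext
      · rw [Category.assoc, h.lift_fst, hs1, Category.id_comp]
      · rw [Category.assoc, h.lift_snd, hs2, Category.id_comp]
    · rw [← sub_eq_zero]
      set D := h.lift p' t' hpt ≫ (s₀ - r ≫ i') - 𝟙 E' with hD
      have h1 : D ≫ p' = 0 := by
        rw [hD, Preadditive.sub_comp, Category.assoc, hs1, h.lift_fst, Category.id_comp, sub_self]
      have h2 : D ≫ t' = 0 := by
        rw [hD, Preadditive.sub_comp, Category.assoc, hs2, h.lift_snd, Category.id_comp, sub_self]
      obtain ⟨v, hv⟩ := hE'.exists_lift D h1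
      have hv0 : v = 0 := by
        rw [← cancel_mono k, zero_comp, ← hit, ← Category.assoc, hv, h2]
      rw [← hv, hv0, zero_comp]
  have hc' : IsConflation (i' ≫ e.inv) fst :=
    ⟨_, distTriang_of_iso₂ hE ((ObjectProperty.ι _).mapIso e)
      (congrArg (·.hom) (show (i' ≫ e.inv) ≫ e.hom = i' by simp)) (congrArg (·.hom) hs1)⟩
  exact hc'.normalEpi hab

lemma normalMono_of_isPushout {W X Y Z : (σ.phaseInterval (Set.Ioo a b)).FullSubcategory}
    {f : Z ⟶ X} {g : Z ⟶ Y} {inl : X ⟶ W} {inr : Y ⟶ W} (h : IsPushout f g inl inr)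
    (hg : Nonempty (NormalMono g)) : Nonempty (NormalMono inl) := by
  obtain ⟨Q, q, hc⟩ := exists_conflation_of_normalMono hab hg
  have hqepi := hc.epi hab
  obtain ⟨d, hT⟩ := id hc
  obtain ⟨E, i, p, hE⟩ := distinguished_cocone_triangle₂ (d ≫ f.hom⟦1⟧')
  obtain ⟨t, ht1, ht2⟩ := complete_distinguished_triangle_morphism₂ _ _ hT hE f.hom (𝟙 Q.obj)
    (by
      change d ≫ f.hom⟦1⟧' = 𝟙 Q.obj ≫ d ≫ f.hom⟦1⟧'
      rw [Category.id_comp])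
  change g.hom ≫ t = f.hom ≫ i at ht1
  change q.hom ≫ 𝟙 Q.obj = t ≫ p at ht2
  rw [Category.comp_id] at ht2
  let E' : (σ.phaseInterval (Set.Ioo a b)).FullSubcategory :=
    ⟨E, Slice.ofExtension ⟨_, _, _, hE⟩ X.property Q.property⟩
  let i' : X ⟶ E' := ObjectProperty.homMk i
  let p' : E' ⟶ Q := ObjectProperty.homMk p
  let t' : Y ⟶ E' := ObjectProperty.homMk t
  have hE' : IsConflation i' p' := ⟨_, hE⟩
  have htp : t' ≫ p' = q := ObjectProperty.hom_ext _ ht2.symm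
  have hft : f ≫ i' = g ≫ t' := ObjectProperty.hom_ext _ ht1.symm
  have hdg : d ≫ g.hom⟦1⟧' = 0 := comp_distTriang_mor_zero₃₁ _ hT
  obtain ⟨s₀, hs₀⟩ : ∃ s₀ : E' ⟶ W, i' ≫ s₀ = inl := by
    -- Extending `inl` along `i` amounts to a map of triangles into the contractible triangle on
    -- `W`; the obstruction vanishes since `f ≫ inl = g ≫ inr` and `d ≫ g⟦1⟧' = 0`.
    obtain ⟨s, hs, -⟩ := complete_distinguished_triangle_morphism₂ _ _ hE
      (contractible_distinguished W.obj) inl.hom 0 (by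
        change (d ≫ f.hom⟦1⟧') ≫ inl.hom⟦1⟧' = 0 ≫ 0
        have hw : f.hom ≫ inl.hom = g.hom ≫ inr.hom := congrArg (·.hom) h.w
        rw [Category.assoc, ← Functor.map_comp, hw, Functor.map_comp, ← Category.assoc, hdg,
          zero_comp, zero_comp])
    change i ≫ s = inl.hom ≫ 𝟙 W.obj at hs
    rw [Category.comp_id] at hs
    exact ⟨ObjectProperty.homMk s, ObjectProperty.hom_ext _ hs⟩
  obtain ⟨r, hr⟩ := hc.exists_desc (t' ≫ s₀ - inr) (by
    rw [Preadditive.comp_sub, ← Category.assoc, ← hft, Category.assoc, hs₀, h.w, sub_self])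
  have hs1 : i' ≫ (s₀ - p' ≫ r) = inl := by
    rw [Preadditive.comp_sub, ← Category.assoc i', hE'.comp_eq_zero, zero_comp, sub_zero, hs₀]
  have hs2 : t' ≫ (s₀ - p' ≫ r) = inr := by
    rw [Preadditive.comp_sub, ← Category.assoc t' p', htp, hr, sub_sub_cancel]
  let e : W ≅ E' := by
    refine ⟨h.desc i' t' hft, s₀ - p' ≫ r, ?_, ?_⟩
    · apply h.hom_ext
      · rw [← Category.assoc, h.inl_desc, hs1, Category.comp_id]
      · rw [← Category.assoc, h.inr_desc, hs2, Category.comp_id]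
    · rw [← sub_eq_zero]
      set D := (s₀ - p' ≫ r) ≫ h.desc i' t' hft - 𝟙 E' with hD
      have h1 : i' ≫ D = 0 := by
        rw [hD, Preadditive.comp_sub, ← Category.assoc, hs1, h.inl_desc, Category.comp_id,
          sub_self]
      have h2 : t' ≫ D = 0 := by
        rw [hD, Preadditive.comp_sub, ← Category.assoc, hs2, h.inr_desc, Category.comp_id,
          sub_self]
      obtain ⟨v, hv⟩ := hE'.exists_desc D h1
      have hv0 : v = 0 := by
        rw [← cancel_epi q, comp_zero, ← htp, Category.assoc, hv, h2]
      rw [← hv, hv0, comp_zero]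
  have hc' : IsConflation inl (e.hom ≫ p') :=
    ⟨_, distTriang_of_iso₂ hE ((ObjectProperty.ι _).mapIso e)
      (congrArg (·.hom) (h.inl_desc i' t' hft)) rfl⟩
  exact hc'.normalMono hab

/-- The category `P(a, b)` is quasi-abelian if `b ≤ a + 1`. -/
theorem isQuasiAbelian_phaseInterval :
    IsQuasiAbelian (σ.phaseInterval (Set.Ioo a b)).FullSubcategory where
  hasFiniteBiproducts := by
    have : (σ.phaseInterval (Set.Ioo a b)).IsClosedUnderIsomorphisms :=
      ⟨fun e h => Slice.ofIso e h⟩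
    have : (σ.phaseInterval (Set.Ioo a b)).ContainsZero :=
      ⟨_, isZero_zero C, Slice.ofIsZero (isZero_zero C)⟩
    have : (σ.phaseInterval (Set.Ioo a b)).IsClosedUnderBinaryProducts :=
      { limitsOfShape_le := by
          rintro X ⟨p⟩
          refine Slice.ofIso ?_ (Slice.ofExtension
            (.of_distTriang (binaryProductTriangle_distinguished _ _))
            (p.prop_diag_obj (.mk .left)) (p.prop_diag_obj (.mk .right)))
          exact IsLimit.conePointUniqueUpToIso (prodIsProd _ _)
            ((IsLimit.postcomposeHomEquiv (diagramIsoPair p.diag) _).2 p.isLimit) }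
    have : (σ.phaseInterval (Set.Ioo a b)).IsClosedUnderFiniteProducts := .mk'
    exact HasFiniteBiproducts.of_hasFiniteProducts
  hasKernels := ⟨fun f => by
    obtain ⟨K, Q, k, p, hc, hk, hlift⟩ := exists_kernel_conflation hab f
    have := hc.mono hab
    exact ⟨⟨_, KernelFork.IsLimit.ofι' k hk fun w hw => ⟨_, (hlift _ w hw).choose_spec⟩⟩⟩⟩
  hasCokernels := ⟨fun f => by
    obtain ⟨K, Q, k, p, hc, hk, hdesc⟩ := exists_cokernel_conflation hab f
    have := hc.epi hab
    exact ⟨⟨_, CokernelCofork.IsColimit.ofπ' p hk fun w hw =>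
      ⟨_, (hdesc _ w hw).choose_spec⟩⟩⟩⟩
  strictEpi_pullback _ _ _ _ h hg := normalEpi_of_isPullback hab h hg
  strictMono_pushout _ _ _ _ h hg := normalMono_of_isPushout hab h hg

end PhaseInterval

end Stability

namespace Stability

/-! ### Rank functions on strict subobjects -/

section Rank

variable {D : Type u} [Category.{v} D] [Preadditive D]

lemma IsArtinianNoetherian.of_strictMono (hD : IsQuasiAbelian D)
    (h : ∀ X : D, ∃ (N : ℕ) (r : StrictSubobject X → ℕ), StrictMono r ∧ ∀ S, r S ≤ N) :
    IsArtinianNoetherian D where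
  isQuasiAbelian := hD
  artinian X := by
    obtain ⟨N, r, hr, -⟩ := h X
    exact hr.wellFoundedLT
  noetherian X := by
    obtain ⟨N, r, hr, hN⟩ := h X
    have : StrictMono fun S => (⟨r S, Nat.lt_succ_of_le (hN S)⟩ : Fin (N + 1)) :=
      fun S T hST => hr hST
    exact this.wellFoundedGT

/-- A bounded, strictly increasing rank bounds chain lengths. Nonemptiness supplies a chain of
length 0, so the supremum of the lengths is attained. -/
lemma IsLengthCategory.of_strictMono (hD : IsQuasiAbelian D)
    (h0 : ∀ X : D, Nonempty (StrictSubobject X))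
    (h : ∀ X : D, ∃ (N : ℕ) (r : StrictSubobject X → ℕ), StrictMono r ∧ ∀ S, r S ≤ N) :
    IsLengthCategory D where
  isQuasiAbelian := hD
  exists_length X _ := by
    obtain ⟨N, r, hr, hN⟩ := h X
    obtain ⟨S⟩ := h0 X
    have hbdd : ∀ p : LTSeries (StrictSubobject X), p.length ≤ N := fun p => by
      have h1 := (p.map r hr).head_add_length_le_nat
      have h2 : (p.map r hr).last ≤ N := hN _
      have h3 : (p.map r hr).length = p.length := rfl
      omega
    have hb : BddAbove (Set.range fun p : LTSeries (StrictSubobject X) => p.length) :=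
      ⟨N, Set.forall_mem_range.2 hbdd⟩
    exact ⟨_, fun p => le_csSup hb (Set.mem_range_self p),
      Nat.sSup_mem ⟨_, Set.mem_range_self (RelSeries.singleton _ S)⟩ hb⟩

end Rank

variable {C : Type u} [Category.{v} C] [Preadditive C] [HasZeroObject C] [HasShift C ℤ]
  [∀ n : ℤ, (shiftFunctor C n).Additive] [Pretriangulated C] [IsTriangulated C]

/-! ### Chains of strict subobjects in `P(a, b)` -/

section Length

variable {σ : StabilityCondition C} {a b : ℝ} (hab : b ≤ a + 1)
include hab

omit [IsTriangulated C] in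
lemma nonempty_strictSubobject (X : (σ.phaseInterval (Set.Ioo a b)).FullSubcategory) :
    Nonempty (StrictSubobject X) := by
  let Z : (σ.phaseInterval (Set.Ioo a b)).FullSubcategory :=
    ⟨_, Slice.ofIsZero (isZero_zero C)⟩
  have : IsIso (⊤ : Subobject X).arrow.hom :=
    inferInstanceAs (IsIso ((ObjectProperty.ι _).map (⊤ : Subobject X).arrow))
  have hc : IsConflation (⊤ : Subobject X).arrow (0 : X ⟶ Z) :=
    ⟨0, (Triangle.distinguished_iff_of_isZero₃ _ (isZero_zero C)).2 this⟩
  exact ⟨⟨⊤, hc.normalMono hab⟩⟩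

/-- The successive quotients in a chain of strict subobjects of `X` are again in `P(a, b)`. -/
lemma exists_extension_of_lt {X : (σ.phaseInterval (Set.Ioo a b)).FullSubcategory}
    {S T : StrictSubobject X} (hST : S < T) :
    ∃ R : C, Slice σ.P (Set.Ioo a b) R ∧ ¬ IsZero R ∧
      IsExtension (S.1 : (σ.phaseInterval (Set.Ioo a b)).FullSubcategory).obj
        (T.1 : (σ.phaseInterval (Set.Ioo a b)).FullSubcategory).obj R := by
  obtain ⟨Q, p, d, hQ⟩ := exists_conflation_of_normalMono hab S.2
  obtain ⟨Q', p', d', hQ'⟩ := exists_conflation_of_normalMono hab T.2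
  have hle : S.1 ≤ T.1 := hST.le
  have hcomp : (Subobject.ofLE S.1 T.1 hle).hom ≫ T.1.arrow.hom = S.1.arrow.hom :=
    congrArg (·.hom) (Subobject.ofLE_arrow hle)
  obtain ⟨R, r, e, hR⟩ := distinguished_cocone_triangle (Subobject.ofLE S.1 T.1 hle).hom
  have e₁ : IsExtension (S.1 : (σ.phaseInterval (Set.Ioo a b)).FullSubcategory).obj
      (T.1 : (σ.phaseInterval (Set.Ioo a b)).FullSubcategory).obj R := ⟨_, _, _, hR⟩
  -- The octahedron for `S ⟶ T ⟶ X`. The lower phase bound for `R` comes from `T` and `S⟦1⟧`, the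
  -- upper one from `Q` and `Q'⟦-1⟧`.
  have e₂ : IsExtension R Q.obj Q'.obj :=
    ⟨_, _, _, (Triangulated.someOctahedron hcomp hR hQ' hQ).mem⟩
  refine ⟨R, slice_Ioo_of_Ioi_of_Iio ?_ ?_, fun h0 => ?_, e₁⟩
  · refine .ofExtension e₁.rotate (Slice.mono (J := Set.Ioo a b) (fun φ hφ => hφ.1)
      (T.1 : (σ.phaseInterval (Set.Ioo a b)).FullSubcategory).property)
      (Slice.shift σ.isPreslicing (J := Set.Ioo a b) (fun φ hφ => ?_)
        (S.1 : (σ.phaseInterval (Set.Ioo a b)).FullSubcategory).property)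
    have := hφ.1
    simp only [Set.mem_Ioi]
    linarith
  · refine .ofExtension e₂.invRotate (Slice.unshift σ.isPreslicing (J := Set.Ioo a b)
      (fun φ hφ => ?_) Q'.property)
      (Slice.mono (J := Set.Ioo a b) (fun φ hφ => hφ.2) Q.property)
    have := hφ.2
    simp only [Set.mem_Iio]
    linarith
  · have h1 : IsIso (Subobject.ofLE S.1 T.1 hle).hom :=
      (Triangle.isZero₃_iff_isIso₁ _ hR).1 h0
    have h2 : IsIso (Subobject.ofLE S.1 T.1 hle) :=
      (ObjectProperty.isIso_hom_iff _).1 h1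
    refine hST.not_ge (show T.1 ≤ S.1 from ?_)
    exact Subobject.le_of_comm (inv (Subobject.ofLE S.1 T.1 hle)) (by
      rw [IsIso.inv_comp_eq, Subobject.ofLE_arrow])

/-- A function which is additive on exact triangles and bounded below on the nonzero objects of
`P(a, b)` bounds the lengths of the chains of strict subobjects. -/
lemma exists_strictMono_of_additive {f : C → ℝ} {δ : ℝ} (hδ : 0 < δ)
    (hadd : ∀ {A X B : C}, IsExtension A X B → f X = f A + f B)
    (hf : ∀ X, Slice σ.P (Set.Ioo a b) X → ¬ IsZero X → δ ≤ f X)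
    (X : (σ.phaseInterval (Set.Ioo a b)).FullSubcategory) :
    ∃ (N : ℕ) (r : StrictSubobject X → ℕ), StrictMono r ∧ ∀ S, r S ≤ N := by
  have hzero : ∀ Y : C, IsZero Y → f Y = 0 := fun Y hY => by
    have := hadd (IsExtension.of_iso_of_isZero (Iso.refl Y) hY)
    linarith
  have hnonneg : ∀ Y : C, Slice σ.P (Set.Ioo a b) Y → 0 ≤ f Y := fun Y hY => by
    by_cases h0 : IsZero Y
    · rw [hzero Y h0]
    · exact hδ.le.trans (hf Y hY h0)
  -- A strict inclusion raises `f / δ` by at least 1, so its integer part is a strictly increasing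
  -- rank.
  refine ⟨⌊f X.obj / δ⌋₊, fun S =>
    ⌊f (S.1 : (σ.phaseInterval (Set.Ioo a b)).FullSubcategory).obj / δ⌋₊, fun S T hST => ?_,
    fun S => ?_⟩
  · obtain ⟨R, hR, hR0, hext⟩ := exists_extension_of_lt hab hST
    have h1 := hnonneg _ (S.1 : (σ.phaseInterval (Set.Ioo a b)).FullSubcategory).property
    have h2 : f (S.1 : (σ.phaseInterval (Set.Ioo a b)).FullSubcategory).obj / δ + 1 ≤
        f (T.1 : (σ.phaseInterval (Set.Ioo a b)).FullSubcategory).obj / δ := by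
      rw [hadd hext, add_div]
      exact add_le_add le_rfl ((one_le_div hδ).2 (hf R hR hR0))
    rw [← Nat.add_one_le_iff, ← Nat.floor_add_one (div_nonneg h1 hδ.le)]
    exact Nat.floor_le_floor h2
  · obtain ⟨Q, p, d, hQ⟩ := exists_conflation_of_normalMono hab S.2
    refine Nat.floor_le_floor (div_le_div_of_nonneg_right ?_ hδ.le)
    have := hadd (A := (S.1 : (σ.phaseInterval (Set.Ioo a b)).FullSubcategory).obj)
      (X := X.obj) (B := Q.obj) ⟨_, _, _, hQ⟩
    have := hnonneg _ Q.property
    linarith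

end Length

/-! ### Local finiteness and locally-length from a mass bound -/

namespace StabilityCondition

variable {σ : StabilityCondition C} {δ : ℝ} (hδ : 0 < δ)
  (hσ : ∀ X, ¬ IsZero X → δ ≤ σ.mass X)
include hδ hσ

lemma exists_strictMono_of_mass_bound (t : ℝ)
    (X : (σ.phaseInterval (Set.Ioo (t - 1 / 8) (t + 1 / 8))).FullSubcategory) :
    ∃ (N : ℕ) (r : StrictSubobject X → ℕ), StrictMono r ∧ ∀ S, r S ≤ N := by
  set u : ℂ := Complex.exp (Complex.I * Real.pi * t) with hu
  have hnorm : ‖u‖ = 1 := by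
    rw [hu, show Complex.I * Real.pi * t = ((Real.pi * t : ℝ) : ℂ) * Complex.I by
      push_cast; ring, Complex.norm_exp_ofReal_mul_I]
  have hconj : u * (starRingEnd ℂ) u = 1 := by
    rw [Complex.mul_conj, Complex.normSq_eq_norm_sq, hnorm]
    simp
  -- The charge rotated by the conjugate of `exp (iπt)` has real part at least `mass · (1 - π / 8)`,
  -- which is at least `δ / 2` since `π < 4`.
  refine exists_strictMono_of_additive (by linarith)
    (f := fun Y => (σ.Z (K0.mk Y) * (starRingEnd ℂ) u).re) (half_pos hδ)
    (fun h => by rw [h.k0_mk, map_add, add_mul, Complex.add_re]) (fun Y hY hY0 => ?_) X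
  have h1 := norm_charge_sub_le hY
  have h2 : ‖(σ.Z (K0.mk Y) - σ.mass Y * u) * (starRingEnd ℂ) u‖ ≤
      σ.mass Y * (Real.pi * (1 / 8)) := by
    rw [norm_mul, Complex.norm_conj, hnorm, mul_one]
    exact h1
  rw [sub_mul, mul_assoc, hconj, mul_one] at h2
  have h3 := (Complex.abs_re_le_norm _).trans h2
  rw [Complex.sub_re, Complex.ofReal_re] at h3
  have h4 := (abs_le.1 h3).1
  have h5 := hσ Y hY0
  have h6 := Real.pi_lt_four
  nlinarith

lemma isLocallyFinite_of_mass_bound : σ.IsLocallyFinite := fun t =>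
  ⟨1 / 8, by norm_num, by norm_num, .of_strictMono (isQuasiAbelian_phaseInterval (by linarith))
    (exists_strictMono_of_mass_bound hδ hσ t)⟩

lemma isLocallyLength_of_mass_bound : σ.IsLocallyLength := fun t =>
  ⟨1 / 8, by norm_num, by norm_num, .of_strictMono (isQuasiAbelian_phaseInterval (by linarith))
    (nonempty_strictSubobject (by linarith)) (exists_strictMono_of_mass_bound hδ hσ t)⟩

end StabilityCondition

end Stability

namespace Stability

variable {C : Type u} [Category.{v} C] [Preadditive C] [HasZeroObject C] [HasShift C ℤ]
  [∀ n : ℤ, (shiftFunctor C n).Additive] [Pretriangulated C]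

/-! ### The generalised metric -/

namespace StabilityCondition

variable {σ τ : StabilityCondition C} {X : C}

lemma edist_le_ofReal_iff {ε : ℝ} (hε : 0 ≤ ε) :
    edist σ τ ≤ ENNReal.ofReal ε ↔ ∀ X, ¬ IsZero X → distAt σ τ X ≤ ε := by
  change StabilityCondition.dist σ τ ≤ _ ↔ _
  simp only [StabilityCondition.dist, iSup_le_iff, ENNReal.ofReal_le_ofReal_iff hε]

lemma mass_le_exp_mul {ε : ℝ} (hX : ¬ IsZero X) (h : distAt σ τ X ≤ ε) :
    σ.mass X ≤ Real.exp ε * τ.mass X := by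
  have h1 := (le_abs_self _).trans ((le_max_right _ _).trans h)
  rwa [Real.log_le_iff_le_exp (div_pos (σ.mass_pos X hX) (τ.mass_pos X hX)),
    div_le_iff₀ (τ.mass_pos X hX)] at h1

variable [IsTriangulated C]

/-- Equal extreme phases give the same semistable objects. On these the charge is determined by
phase and mass, and Harder–Narasimhan filtrations carry the equality to all classes. -/
lemma eq_of_edist_eq_zero (h : edist σ τ = 0) : σ = τ := by
  have hd : ∀ X, ¬ IsZero X → distAt σ τ X ≤ 0 :=
    (edist_le_ofReal_iff le_rfl).1 (by rw [h, ENNReal.ofReal_zero])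
  have hP : σ.P = τ.P := by
    funext φ X
    by_cases h0 : IsZero X
    · exact propext ⟨fun _ => τ.P_zero φ X h0, fun _ => σ.P_zero φ X h0⟩
    · have h1 := ((le_max_left _ _).trans (le_max_left _ _)).trans (hd X h0)
      have h2 := ((le_max_right _ _).trans (le_max_left _ _)).trans (hd X h0)
      rw [abs_nonpos_iff, sub_eq_zero] at h1 h2
      rw [semistable_iff h0, semistable_iff h0, h1, h2]
  have hmass : ∀ X, σ.mass X = τ.mass X := fun X => by
    by_cases h0 : IsZero X
    · rw [mass_of_isZero _ h0, mass_of_isZero _ h0]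
    · have h1 := mass_le_exp_mul h0 (hd X h0)
      have h2 := mass_le_exp_mul h0 ((distAt_comm τ σ X).le.trans (hd X h0))
      rw [Real.exp_zero, one_mul] at h1 h2
      exact le_antisymm h1 h2
  have hZ : σ.Z = τ.Z := K0.addHom_ext fun X => by
    obtain ⟨l, hl⟩ := σ.exists_isHN X
    rw [hl.k0_mk, map_list_sum, map_list_sum, List.map_map, List.map_map]
    refine congrArg _ (List.map_congr_left fun p hp => ?_)
    have hp' := (hl.mem p hp).1
    change σ.Z (K0.mk p.2) = τ.Z (K0.mk p.2)
    rw [charge_eq hp', hmass, ← charge_eq (hP ▸ hp')]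
  cases σ
  cases τ
  simp only at hP hZ
  subst hP hZ
  rfl

end StabilityCondition

open StabilityCondition

/-! ### The support property on full components -/

/-- Coordinates on the free quotient of `A` by torsion. Torsion is harmless because every
homomorphism to `ℂ` kills it. -/
lemma exists_intCoordinates (A : Type w) [AddCommGroup A] [Module.Finite ℤ A] :
    ∃ (n : ℕ) (u : Fin n → A →+ ℤ), ∀ a, (∀ i, u i a = 0) → ∃ k : ℤ, k ≠ 0 ∧ k • a = 0 := by
  let b := Module.finBasis ℤ (A ⧸ Submodule.torsion ℤ A)
  refine ⟨_, fun i => ((b.coord i).comp (Submodule.mkQ _)).toAddMonoidHom, fun a ha => ?_⟩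
  have h0 : (Submodule.torsion ℤ A).mkQ a = 0 := (b.forall_coord_eq_zero_iff).1 ha
  rw [Submodule.mkQ_apply, Submodule.Quotient.mk_eq_zero, Submodule.mem_torsion_iff] at h0
  obtain ⟨k, hk⟩ := h0
  exact ⟨k, nonZeroDivisors.coe_ne_zero k, hk⟩

section Full

variable {A : Type w} [AddCommGroup A] {q : K0 C →+ A}

lemma StabThrough.Z_mk (σ : StabThrough q) (x : K0 C) :
    σ.toStabilityCondition.Z x = σ.charge (q x) := by
  rw [← σ.charge_comp]
  rfl

/-- The line through `c` with direction given by an integral linear form. -/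
def intLine (c : A →+ ℂ) (u : A →+ ℤ) (t : ℝ) : A →+ ℂ :=
  c + (AddMonoidHom.mulLeft (t : ℂ)).comp ((Int.castAddHom ℂ).comp u)

lemma intLine_apply (c : A →+ ℂ) (u : A →+ ℤ) (t : ℝ) (a : A) :
    intLine c u t a = c a + t * (u a : ℂ) := rfl

lemma continuous_intLine (c : A →+ ℂ) (u : A →+ ℤ) : Continuous (intLine c u) := by
  refine continuous_induced_rng.2 (continuous_pi fun a => ?_)
  change Continuous fun t : ℝ => c a + t * (u a : ℂ)
  fun_prop

variable [IsTriangulated C]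

/-- On a full set of stability conditions the charges of the nonzero semistable objects are
bounded away from zero. -/
theorem IsFull.exists_charge_bound [Module.Finite ℤ A] {S : Set (StabThrough q)} (hfull : IsFull S) (σ : S) :
    ∃ δ > 0, ∀ (φ : ℝ) (E : C), σ.1.toStabilityCondition.P φ E → ¬ IsZero E →
      δ ≤ ‖σ.1.toStabilityCondition.Z (K0.mk E)‖ := by
  obtain ⟨n, u, hu⟩ := exists_intCoordinates A
  have hball : {τ : S | edist τ σ < 1} ∈ 𝓝 σ := Metric.eball_mem_nhds σ one_pos
  have himg := hfull.isOpenMap.image_mem_nhds hball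
  -- The projection to charges is open, so the unit ball around `σ` covers a neighbourhood of its
  -- charge. Having finitely many directions allows a single `t > 0` for all of them.
  have hline : ∀ i, ∀ᶠ t in 𝓝 (0 : ℝ), intLine σ.1.charge (u i) t ∈
      (fun τ : S => (τ : StabThrough q).charge) '' {τ : S | edist τ σ < 1} := fun i => by
    refine (continuous_intLine σ.1.charge (u i)).continuousAt ?_
    convert himg using 2
    ext a
    simp [intLine_apply]
  obtain ⟨t, ht, ht0⟩ := ((eventually_all.2 hline).filter_mono nhdsWithin_le_nhds).and
    (self_mem_nhdsWithin (s := Set.Ioi (0 : ℝ))) |>.exists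
  -- The constant comes from `t ≤ |Z_τ(E) - Z_σ(E)| ≤ m_τ(E) + m_σ(E) ≤ (e + 1) m_σ(E)`, with
  -- `m_σ(E) = |Z_σ(E)|` for semistable `E`.
  refine ⟨t / (1 + Real.exp 1), div_pos ht0 (by positivity), fun φ E hE hE0 => ?_⟩
  have hne : σ.1.charge (q (K0.mk E)) ≠ 0 := by
    rw [← StabThrough.Z_mk, ← norm_ne_zero_iff, ← mass_semistable hE]
    exact (mass_pos _ E hE0).ne'
  obtain ⟨i, hi⟩ : ∃ i, u i (q (K0.mk E)) ≠ 0 := by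
    by_contra! h
    obtain ⟨k, hk, hk'⟩ := hu _ h
    have h1 := map_zsmul σ.1.charge k (q (K0.mk E))
    rw [hk', map_zero, eq_comm, smul_eq_zero] at h1
    exact h1.elim hk hne
  obtain ⟨τ, hτ, hτi⟩ := ht i
  have hτ' : edist τ.1.toStabilityCondition σ.1.toStabilityCondition ≤ ENNReal.ofReal 1 := by
    rw [ENNReal.ofReal_one]
    exact (show edist τ σ < 1 from hτ).le
  have h1 := mass_le_exp_mul hE0 ((edist_le_ofReal_iff zero_le_one).1 hτ' E hE0)
  rw [mass_semistable hE] at h1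
  have h2 := (norm_charge_le_mass τ.1.toStabilityCondition E).trans h1
  have h3 : τ.1.toStabilityCondition.Z (K0.mk E) - σ.1.toStabilityCondition.Z (K0.mk E) =
      t * (u i (q (K0.mk E)) : ℂ) := by
    rw [StabThrough.Z_mk, StabThrough.Z_mk, show τ.1.charge = _ from hτi, intLine_apply,
      add_sub_cancel_left]
  have h4 : t ≤ ‖(t : ℂ) * (u i (q (K0.mk E)) : ℂ)‖ := by
    rw [norm_mul, Complex.norm_real, Real.norm_of_nonneg (le_of_lt ht0), Complex.norm_intCast]
    have : (1 : ℝ) ≤ |(u i (q (K0.mk E)) : ℝ)| := by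
      exact_mod_cast Int.one_le_abs hi
    nlinarith [show 0 < t from ht0]
  rw [div_le_iff₀ (by positivity)]
  rw [← h3] at h4
  have h5 := h4.trans (norm_sub_le _ _)
  linarith

/-! ### Completeness -/

variable {σ : ℕ → StabilityCondition C}

omit [IsTriangulated C] in
lemma IsDistCauchy.of_cauchySeq (h : CauchySeq σ) : IsDistCauchy σ := fun ε hε => by
  obtain ⟨N, hN⟩ := EMetric.cauchySeq_iff.1 h (ENNReal.ofReal ε) (ENNReal.ofReal_pos.2 hε)
  exact ⟨N, fun m hm n hn => (edist_le_ofReal_iff hε.le).1 (hN m hm n hn).le⟩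

-- Beyond an index `N` where distances are at most 1, masses differ from those of `σ N` by at most a
-- factor `e`; so the bound for `σ N` alone suffices.
omit [IsTriangulated C] in
lemma IsDistCauchy.exists_mass_bound (h : IsDistCauchy σ)
    (hσ : ∀ n, ∃ δ > 0, ∀ X, ¬ IsZero X → δ ≤ (σ n).mass X) :
    ∃ δ > 0, ∀ᶠ n in atTop, ∀ X, ¬ IsZero X → δ ≤ (σ n).mass X := by
  obtain ⟨N, hN⟩ := h 1 one_pos
  obtain ⟨δ, hδ, hδN⟩ := hσ N
  refine ⟨δ / Real.exp 1, by positivity, (eventually_ge_atTop N).mono fun n hn X hX => ?_⟩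
  rw [div_le_iff₀ (Real.exp_pos 1), mul_comm]
  exact (hδN X hX).trans (mass_le_exp_mul hX (hN N le_rfl n hn X hX))

/-- A Cauchy sequence of stability conditions each of which has masses bounded below converges to
a stability condition with masses bounded below. -/
theorem exists_tendsto_of_mass_bound (h : CauchySeq σ)
    (hσ : ∀ n, ∃ δ > 0, ∀ X, ¬ IsZero X → δ ≤ (σ n).mass X) :
    ∃ τ : StabilityCondition C, Tendsto σ atTop (𝓝 τ) ∧ τ.P = limitingSemistable σ ∧
      (∀ x, Tendsto (fun n => (σ n).Z x) atTop (𝓝 (τ.Z x))) ∧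
      ∃ δ > 0, ∀ X, ¬ IsZero X → δ ≤ τ.mass X := by
  have hC := IsDistCauchy.of_cauchySeq h
  obtain ⟨δ, hδ, hδσ⟩ := hC.exists_mass_bound hσ
  obtain ⟨τ, hP, hZ, hτ⟩ := hC.exists_limit hδ (hδσ.mono fun n hn φ E hE hE0 => by
    rw [← mass_semistable hE]
    exact hn E hE0)
  refine ⟨τ, ?_, hP, hZ, δ, hδ, fun X hX =>
    ge_of_tendsto (hτ X hX).2.2 (hδσ.mono fun n hn => hn X hX)⟩
  refine EMetric.tendsto_atTop.2 fun ε hε => ?_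
  obtain ⟨r, hr0, hrε⟩ : ∃ r : ℝ, 0 < r ∧ ENNReal.ofReal r < ε := by
    obtain ⟨r, hr, hr'⟩ := ENNReal.lt_iff_exists_nnreal_btwn.1 hε
    exact ⟨r, by exact_mod_cast hr, by simpa using hr'⟩
  obtain ⟨N, hN⟩ := hC r hr0
  refine ⟨N, fun n hn => ((edist_le_ofReal_iff hr0.le).2 fun X hX => ?_).trans_lt hrε⟩
  obtain ⟨h1, h2, h3⟩ := hτ X hX
  -- The Cauchy estimate is uniform in `X`, so a pointwise limit in the second index preserves the
  -- uniform bound.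
  have hlim : Tendsto (fun m => distAt (σ n) (σ m) X) atTop (𝓝 (distAt (σ n) τ X)) := by
    refine ((tendsto_const_nhds.sub h2).abs.max (tendsto_const_nhds.sub h1).abs).max ?_
    refine ((tendsto_const_nhds.div h3 (mass_pos τ X hX).ne').log ?_).abs
    exact (div_pos (mass_pos _ X hX) (mass_pos τ X hX)).ne'
  exact le_of_tendsto hlim ((eventually_ge_atTop N).mono fun m hm => hN n hn m hm X hX)

lemma StabThrough.eq_of_edist_eq_zero (hq : Function.Surjective q) {σ τ : StabThrough q}
    (h : edist σ τ = 0) : σ = τ := by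
  have h1 : σ.toStabilityCondition = τ.toStabilityCondition :=
    StabilityCondition.eq_of_edist_eq_zero h
  obtain ⟨s, _, c, hc⟩ := σ
  obtain ⟨s', _, c', hc'⟩ := τ
  obtain rfl : s = s' := h1
  obtain rfl : c = c' := (AddMonoidHom.cancel_right hq).1 (hc.trans hc'.symm)
  rfl

end Full

end Stability

/-! ### The completeness theorem -/

open Stability in
theorem theorem3p5 {C : Type u} [CategoryTheory.Category.{v} C]
    [CategoryTheory.Preadditive C] [CategoryTheory.Limits.HasZeroObject C]
    [CategoryTheory.HasShift C ℤ] [∀ n : ℤ, (CategoryTheory.shiftFunctor C n).Additive]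
    [CategoryTheory.Pretriangulated C] [CategoryTheory.IsTriangulated C]
    {A : Type w} [AddCommGroup A] [Module.Finite ℤ A]
    (q : Stability.K0 C →+ A) (hq : Function.Surjective q)
    (S : Set (Stability.StabThrough q))
    (hS : ∃ σ₀ : Stability.StabThrough q, S = connectedComponent σ₀)
    (hfull : Stability.IsFull S) :
    CompleteSpace S ∧
      ∀ σ : ℕ → S, CauchySeq σ → ∃ τ : S,
        Tendsto σ atTop (𝓝 τ) ∧
        (∀ τ' : S, Tendsto σ atTop (𝓝 τ') → τ' = τ) ∧
        (∀ x : Stability.K0 C,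
          Tendsto (fun n => (σ n).1.toStabilityCondition.Z x) atTop
            (𝓝 (τ.1.toStabilityCondition.Z x))) ∧
        (∀ θ : ℝ, τ.1.toStabilityCondition.P θ =
          Stability.limitingSemistable (fun n => (σ n).1.toStabilityCondition) θ) ∧
        τ.1.toStabilityCondition.IsLocallyLength := by
  suffices h : ∀ σ : ℕ → S, CauchySeq σ → ∃ τ : S,
        Tendsto σ atTop (𝓝 τ) ∧
        (∀ τ' : S, Tendsto σ atTop (𝓝 τ') → τ' = τ) ∧
        (∀ x : Stability.K0 C,
          Tendsto (fun n => (σ n).1.toStabilityCondition.Z x) atTop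
            (𝓝 (τ.1.toStabilityCondition.Z x))) ∧
        (∀ θ : ℝ, τ.1.toStabilityCondition.P θ =
          Stability.limitingSemistable (fun n => (σ n).1.toStabilityCondition) θ) ∧
        τ.1.toStabilityCondition.IsLocallyLength from
    -- The uniformity comes from a generalised metric, so convergence of Cauchy sequences suffices
    -- for completeness.
    ⟨UniformSpace.complete_of_cauchySeq_tendsto fun σ hσ =>
      let ⟨τ, hτ, _⟩ := h σ hσ
      ⟨τ, hτ⟩, h⟩
  intro σ hσ
  have hind : IsUniformInducing (StabThrough.toStabilityCondition (q := q)) := ⟨rfl⟩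
  obtain ⟨τ, hlim, hP, hZ, δ, hδ, hτδ⟩ := exists_tendsto_of_mass_bound
    (hσ.map (hind.uniformContinuous.comp uniformContinuous_subtype_val)) fun n => by
      obtain ⟨δ, hδ, h⟩ := hfull.exists_charge_bound (σ n)
      exact ⟨δ, hδ, fun X hX => StabilityCondition.le_mass hδ.le h hX⟩
  -- Every charge in the sequence vanishes on the kernel of `q`, hence so does the pointwise limit,
  -- which therefore descends to `A`.
  have hker : q.ker ≤ τ.Z.ker := fun x hx => by
    refine tendsto_nhds_unique (hZ x) (tendsto_const_nhds.congr fun n => ?_)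
    change (0 : ℂ) = (σ n).1.toStabilityCondition.Z x
    rw [StabThrough.Z_mk, AddMonoidHom.mem_ker.1 hx, map_zero]
  let τ' : StabThrough q :=
    { toStabilityCondition := τ
      isLocallyFinite := StabilityCondition.isLocallyFinite_of_mass_bound hδ hτδ
      charge := q.liftOfSurjective hq ⟨τ.Z, hker⟩
      charge_comp := q.liftOfRightInverse_comp _ _ ⟨τ.Z, hker⟩ }
  have hlim' : Tendsto (fun n => (σ n).1) atTop (𝓝 τ') := hind.isInducing.tendsto_nhds_iff.2 hlim
  have hmem : τ' ∈ S := by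
    obtain ⟨σ₀, rfl⟩ := hS
    exact isClosed_connectedComponent.mem_of_tendsto hlim' (Eventually.of_forall fun n => (σ n).2)
  have hlimS : Tendsto σ atTop (𝓝 ⟨τ', hmem⟩) := tendsto_subtype_rng.2 hlim'
  refine ⟨⟨τ', hmem⟩, hlimS, fun ρ hρ => Subtype.ext ?_, hZ, fun θ => congrFun hP θ,
    StabilityCondition.isLocallyLength_of_mass_bound hδ hτδ⟩
  -- Two limits are a priori only inseparable; distance zero then gives equality, surjectivity of
  -- `q` identifying the induced charges.
  exact StabThrough.eq_of_edist_eq_zero hq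
    (show edist ρ ⟨τ', hmem⟩ = 0 from
      EMetric.inseparable_iff.1 (tendsto_nhds_unique_inseparable hρ hlimS))
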